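/- Let $\mathcal X$ be a set with a $\sigma$-algebra $\mathcal F$ and let $(\mathcal F_n)_{n\in\mathbb Z}$ be an atomic filtration: an increasing sequence of $\sigma$-algebras $\mathcal F_n\subset\mathcal F$ such that for each $n$ there is a countable collection $\mathcal D_n\subset\mathcal F_n$ of pairwise disjoint sets with the property that every set of $\mathcal F_n$ is a union of sets in $\mathcal D_n$. An atom is a pair $(I,n)$ with $I\in\mathcal D_n$, written simply $I$, with $\operatorname{rk} I=n$; $\mathcal D$ is the collection of all atoms, and for atoms $I\subset J$ means inclusion of the sets together with $\operatorname{rk} I\ge\operatorname{rk} J$. Let $\mathcal F_0$ be the collection of sets $E\cap F$ with $E\in\mathcal F$ and $F$ a finite union of atoms. Let $\mathbb F=\mathbb R$ or $\mathbb C$. Let $W$ be a $d\times d$ matrix-valued measure, i.e. a countably additive function on $\mathcal F_0$ with values in the positive semidefinite $d\times d$ matrices over $\mathbb F$. Write $W=w\,d\tau$, where $\tau=\operatorname{tr}W$ (extended to a $\sigma$-finite measure on $\mathcal F$) and $w$ is a measurable function with positive semidefinite values, and put $\int_E W(dx)f(x):=\int_E w f\,d\tau$ and $$\|f\|_{L^2(W)}^2:=\int_{\mathcal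 X}\langle W(dx)f(x),f(x)\rangle:=\int_{\mathcal X}\langle w f,f\rangle\,d\tau .$$ $L^2(W)$ is the set of measurable $f:\mathcal X\to\mathbb F^d$ with $\|f\|_{L^2(W)}<\infty$. Let $\widetilde A_I$, $I\in\mathcal D$, be positive semidefinite $d\times d$ matrices over $\mathbb F$. Consider, for constants $A,B\in[0,\infty)$, the conditions 1. $\displaystyle\sum_{I\in\mathcal D}\Bigl\|\widetilde A_I^{1/2}\int_I W(dx)f(x)\Bigr\|^2\le A\,\|f\|_{L^2(W)}^2$ for all $f\in L^2(W)$; 2. $\displaystyle\sum_{I\in\mathcal D,\ I\subset I_0}W(I)\,\widetilde A_I\,W(I)\le B\,W(I_0)$ for all $I_0\in\mathcal D$ (the sum converges, and the inequality is in the sense of Hermitian matrices). Then (1) holds with some finite $A$ if and only if (2) holds with some finite $B$. In that case there are smallest constants $A$ in (1) and $B$ in (2), and they satisfy $$B\le A\le C\,B,$$ where $C=C(d)$ depends only on the dimension $d$. -/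

import Mathlib

open scoped MeasureTheory ComplexOrder NNReal ENNReal

/-- An atomic filtration of a measurable space `X`, indexed by `ℤ`: an increasing sequence `F n` of
sub-σ-algebras, each with a countable disjoint collection `atoms n` of members of `F n` such that
every member of `F n` is a union of atoms of generation `n`. -/
structure AtomicFiltration (X : Type*) [mX : MeasurableSpace X] where
  F : MeasureTheory.Filtration ℤ mX
  atoms : ℤ → Set (Set X)
  countable_atoms : ∀ n, (atoms n).Countable
  disjoint_atoms : ∀ n, (atoms n).PairwiseDisjoint id
  measurableSet_atoms : ∀ n, ∀ I ∈ atoms n, MeasurableSet[F n] I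
  eq_sUnion_atoms : ∀ n, ∀ E : Set X, MeasurableSet[F n] E → ∃ S ⊆ atoms n, E = ⋃₀ S

namespace AtomicFiltration

variable {X : Type*} [MeasurableSpace X] (𝓕 : AtomicFiltration X)

/-- An atom, formally a pair `(I, n)` with `I` an atom of generation `n`: one and the same set may
belong to several generations and then gives several atoms. -/
structure Atom where
  carrier : Set X
  rk : ℤ
  mem : carrier ∈ 𝓕.atoms rk

/-- Inclusion of atoms: inclusion of the sets together with `rk I ≥ rk J`. -/
def Atom.Sub {𝓕 : AtomicFiltration X} (I J : 𝓕.Atom) : Prop :=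
  I.carrier ⊆ J.carrier ∧ J.rk ≤ I.rk

/-- The collection `F₀` of the sets `E ∩ F` with `E` measurable and `F` a finite union of atoms. -/
def ring : Set (Set X) :=
  {G | ∃ E : Set X, MeasurableSet E ∧
    ∃ S : Set (Set X), S.Finite ∧ S ⊆ ⋃ n, 𝓕.atoms n ∧ G = E ∩ ⋃₀ S}

theorem measurableSet_of_mem_atoms {n : ℤ} {I : Set X} (hI : I ∈ 𝓕.atoms n) :
    MeasurableSet I :=
  𝓕.F.le' n I (𝓕.measurableSet_atoms n I hI)

theorem sUnion_atoms (n : ℤ) : ⋃₀ 𝓕.atoms n = Set.univ := by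
  obtain ⟨S, hS, h⟩ := 𝓕.eq_sUnion_atoms n Set.univ MeasurableSet.univ
  exact Set.eq_univ_of_univ_subset (h ▸ Set.sUnion_subset_sUnion hS)

theorem inter_mem_ring {n : ℤ} {E I : Set X} (hE : MeasurableSet E) (hI : I ∈ 𝓕.atoms n) :
    E ∩ I ∈ 𝓕.ring :=
  ⟨E, hE, {I}, Set.finite_singleton I,
    Set.singleton_subset_iff.2 (Set.mem_iUnion.2 ⟨n, hI⟩), by simp⟩

theorem mem_ring {n : ℤ} {I : Set X} (hI : I ∈ 𝓕.atoms n) : I ∈ 𝓕.ring := by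
  simpa using 𝓕.inter_mem_ring MeasurableSet.univ hI

theorem inter_mem_ring_left {E G : Set X} (hG : G ∈ 𝓕.ring) (hE : MeasurableSet E) :
    E ∩ G ∈ 𝓕.ring := by
  obtain ⟨E', hE', S, hS, hSs, rfl⟩ := hG
  exact ⟨E ∩ E', hE.inter hE', S, hS, hSs, by rw [Set.inter_assoc]⟩

theorem measurableSet_of_mem_ring {G : Set X} (hG : G ∈ 𝓕.ring) : MeasurableSet G := by
  obtain ⟨E, hE, S, hS, hSs, rfl⟩ := hG
  refine hE.inter (MeasurableSet.sUnion hS.countable fun I hI => ?_)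
  obtain ⟨n, hn⟩ := Set.mem_iUnion.1 (hSs hI)
  exact 𝓕.measurableSet_of_mem_atoms hn

theorem empty_mem_ring : (∅ : Set X) ∈ 𝓕.ring :=
  ⟨∅, MeasurableSet.empty, ∅, Set.finite_empty, Set.empty_subset _, by simp⟩

end AtomicFiltration

open scoped MatrixOrder in
/-- The positive semidefinite square root of a positive semidefinite matrix. -/
noncomputable def psdSqrt {𝕜 : Type*} [RCLike 𝕜] {d : ℕ} (M : Matrix (Fin d) (Fin d) 𝕜) :
    Matrix (Fin d) (Fin d) 𝕜 :=
  CFC.sqrt M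

/-- A `d × d` matrix-valued measure: a countably additive function on `F₀` with values in the set
of positive semidefinite matrices. Only the values on `F₀` are meaningful. -/
structure MatrixMeasure {X : Type*} [MeasurableSpace X] (𝓕 : AtomicFiltration X)
    (𝕜 : Type*) [RCLike 𝕜] (d : ℕ) where
  toFun : Set X → Matrix (Fin d) (Fin d) 𝕜
  posSemidef : ∀ E ∈ 𝓕.ring, (toFun E).PosSemidef
  hasSum_iUnion : ∀ E : ℕ → Set X, (∀ i, E i ∈ 𝓕.ring) → (⋃ i, E i) ∈ 𝓕.ring →
    Pairwise (Function.onFun Disjoint E) → HasSum (fun i => toFun (E i)) (toFun (⋃ i, E i))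

namespace MatrixMeasure

open MeasureTheory

variable {X : Type*} [MeasurableSpace X] {𝓕 : AtomicFiltration X} {𝕜 : Type*} [RCLike 𝕜] {d : ℕ}

instance : CoeFun (MatrixMeasure 𝓕 𝕜 d) fun _ => Set X → Matrix (Fin d) (Fin d) 𝕜 := ⟨toFun⟩

variable (W : MatrixMeasure 𝓕 𝕜 d)

theorem apply_empty : W ∅ = 0 := by
  have h := W.hasSum_iUnion (fun _ => ∅) (fun _ => 𝓕.empty_mem_ring)
    (by simpa using 𝓕.empty_mem_ring) (fun i j _ => by simp [Function.onFun])
  exact tendsto_nhds_unique tendsto_const_nhds h.summable.tendsto_atTop_zero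

theorem hasSum_inter {G : Set X} (hG : G ∈ 𝓕.ring) {ι : Type*} [Countable ι] {E : ι → Set X}
    (hE : ∀ i, MeasurableSet (E i)) (hd : Pairwise (Function.onFun Disjoint E)) :
    HasSum (fun i => W (E i ∩ G)) (W ((⋃ i, E i) ∩ G)) := by
  obtain ⟨e, he⟩ := Countable.exists_injective_nat ι
  classical
  let E' : ℕ → Set X := fun n => {x | ∃ i, e i = n ∧ x ∈ E i ∩ G}
  have hE'e : ∀ i, E' (e i) = E i ∩ G := by
    intro i; ext x; constructor
    · rintro ⟨j, hj, hx⟩; rwa [← he hj]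
    · intro hx; exact ⟨i, rfl, hx⟩
  have hE'n : ∀ n, n ∉ Set.range e → E' n = ∅ := by
    intro n hn; ext x
    simp only [Set.mem_empty_iff_false, iff_false]
    rintro ⟨j, hj, -⟩; exact hn ⟨j, hj⟩
  have hU : (⋃ n, E' n) = (⋃ i, E i) ∩ G := by
    ext x; simp only [E', Set.mem_iUnion, Set.mem_ofPred_eq, Set.mem_inter_iff]
    constructor
    · rintro ⟨n, i, -, hx⟩; exact ⟨⟨i, hx.1⟩, hx.2⟩
    · rintro ⟨⟨i, hx⟩, hg⟩; exact ⟨e i, i, rfl, hx, hg⟩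
  have h := W.hasSum_iUnion E' (fun n => ?_) ?_ ?_
  · rw [hU] at h
    rw [← he.hasSum_iff] at h
    · simpa [Function.comp_def, hE'e] using h
    · intro n hn; rw [hE'n n hn]; exact W.apply_empty
  · by_cases hn : n ∈ Set.range e
    · obtain ⟨i, rfl⟩ := hn
      rw [hE'e]; exact 𝓕.inter_mem_ring_left hG (hE i)
    · rw [hE'n n hn]; exact 𝓕.empty_mem_ring
  · rw [hU]; exact 𝓕.inter_mem_ring_left hG (MeasurableSet.iUnion hE)
  · intro m n hmn
    refine Set.disjoint_left.2 ?_
    rintro x ⟨i, hi, hx⟩ ⟨j, hj, hy⟩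
    have hij : i ≠ j := fun h => hmn (by rw [← hi, ← hj, h])
    exact Set.disjoint_left.1 (hd hij) hx.1 hy.1

theorem re_trace_nonneg {G : Set X} (hG : G ∈ 𝓕.ring) : 0 ≤ RCLike.re (W G).trace :=
  (RCLike.nonneg_iff.1 (W.posSemidef G hG).trace_nonneg).1

theorem hasSum_ofReal_trace {ι : Type*} {E : ι → Set X} {G : Set X}
    (hE : ∀ i, E i ∈ 𝓕.ring) (h : HasSum (fun i => W (E i)) (W G)) :
    ENNReal.ofReal (RCLike.re (W G).trace) =
      ∑' i, ENNReal.ofReal (RCLike.re (W (E i)).trace) := by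
  have h1 : HasSum (fun i => RCLike.re (W (E i)).trace) (RCLike.re (W G).trace) := by
    have h2 : HasSum (fun i => (W (E i)).trace) (W G).trace :=
      h.map (Matrix.traceAddMonoidHom (Fin d) 𝕜) (by
        change Continuous fun A : Matrix (Fin d) (Fin d) 𝕜 => A.trace
        fun_prop)
    exact RCLike.hasSum_re 𝕜 h2
  rw [← h1.tsum_eq, ENNReal.ofReal_tsum_of_nonneg (fun i => W.re_trace_nonneg (hE i)) h1.summable]

/-- The part of the measure `tr W` on an atom. -/
noncomputable def traceOn (n : ℤ) (I : 𝓕.atoms n) : Measure X :=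
  Measure.ofMeasurable (fun E _ => ENNReal.ofReal (RCLike.re (W (E ∩ I)).trace))
    (by simp [W.apply_empty])
    (fun E hE hd => W.hasSum_ofReal_trace (fun i => 𝓕.inter_mem_ring (hE i) I.2)
      (W.hasSum_inter (𝓕.mem_ring I.2) hE hd))

/-- The scalar measure `tr W = ∑ₖ wₖₖ`, extended from `F₀` to a σ-finite measure on the whole
σ-algebra (the extension is assembled from the atoms of generation `0`). -/
noncomputable def traceMeasure : Measure X :=
  Measure.sum fun I : 𝓕.atoms 0 => W.traceOn 0 I

theorem iUnion_atoms (n : ℤ) : (⋃ I : 𝓕.atoms n, (I : Set X)) = Set.univ := by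
  rw [← Set.sUnion_eq_iUnion]; exact 𝓕.sUnion_atoms n

theorem disjoint_atoms (n : ℤ) :
    Pairwise (Function.onFun Disjoint fun I : 𝓕.atoms n => (I : Set X)) :=
  fun I J h => 𝓕.disjoint_atoms n I.2 J.2 fun h' => h (Subtype.ext h')

/-- `tr W` as a measure has the values it should have. -/
theorem traceMeasure_apply {G : Set X} (hG : G ∈ 𝓕.ring) :
    W.traceMeasure G = ENNReal.ofReal (RCLike.re (W G).trace) := by
  have hGm := 𝓕.measurableSet_of_mem_ring hG
  have : Countable (𝓕.atoms 0) := (𝓕.countable_atoms 0).to_subtype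
  have h := W.hasSum_inter hG (E := fun I : 𝓕.atoms 0 => (I : Set X))
    (fun I => 𝓕.measurableSet_of_mem_atoms I.2) (disjoint_atoms 0)
  rw [iUnion_atoms, Set.univ_inter] at h
  rw [W.hasSum_ofReal_trace (fun I => 𝓕.inter_mem_ring_left hG
    (𝓕.measurableSet_of_mem_atoms I.2)) h, traceMeasure, Measure.sum_apply _ hGm]
  refine tsum_congr fun I => ?_
  rw [traceOn, Measure.ofMeasurable_apply _ hGm, Set.inter_comm]

theorem sigmaFinite_traceMeasure : SigmaFinite W.traceMeasure :=
  Measure.sigmaFinite_of_countable (𝓕.countable_atoms 0)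
    (fun I hI => by rw [W.traceMeasure_apply (𝓕.mem_ring hI)]; exact ENNReal.ofReal_lt_top)
    (𝓕.sUnion_atoms 0)

/-- `w` is a density of `W` with respect to `tr W`: a measurable function with positive
semidefinite values such that `W(E) = ∫_E w d(tr W)` entrywise for all `E` in `F₀`. -/
structure IsDensity (w : X → Matrix (Fin d) (Fin d) 𝕜) : Prop where
  measurable : ∀ j k, Measurable fun x => w x j k
  posSemidef : ∀ x, (w x).PosSemidef
  integrableOn : ∀ E ∈ 𝓕.ring, ∀ j k, IntegrableOn (fun x => w x j k) E W.traceMeasure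
  integral_eq : ∀ E ∈ 𝓕.ring, ∀ j k, ∫ x in E, w x j k ∂W.traceMeasure = W E j k

theorem exists_real_density (τ : Measure X) [SigmaFinite τ] (g : Set X → ℝ)
    (hadd : ∀ E : ℕ → Set X, (∀ i, MeasurableSet (E i)) → Pairwise (Function.onFun Disjoint E) →
      HasSum (fun i => g (E i)) (g (⋃ i, E i)))
    (hac : ∀ E, MeasurableSet E → τ E = 0 → g E = 0) :
    ∃ h : X → ℝ, Measurable h ∧ Integrable h τ ∧ ∀ E, MeasurableSet E → ∫ x in E, h x ∂τ = g E := by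
  classical
  let s : SignedMeasure X :=
    { measureOf' := fun E => if MeasurableSet E then g E else 0
      empty' := by
        rw [if_pos MeasurableSet.empty]; exact hac _ MeasurableSet.empty measure_empty
      not_measurable' := fun E hE => if_neg hE
      m_iUnion' := fun E hE hd => by
        simpa [hE, MeasurableSet.iUnion hE] using hadd E hE hd }
  have hs : ∀ E, MeasurableSet E → s E = g E := fun E hE => if_pos hE
  have hsac : s ≪ᵥ τ.toENNRealVectorMeasure := by
    refine VectorMeasure.AbsolutelyContinuous.mk fun E hE h0 => ?_
    rw [Measure.toENNRealVectorMeasure_apply_measurable hE] at h0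
    rw [hs E hE]; exact hac E hE h0
  refine ⟨s.rnDeriv τ, SignedMeasure.measurable_rnDeriv s τ,
    SignedMeasure.integrable_rnDeriv s τ, fun E hE => ?_⟩
  rw [← withDensityᵥ_apply (SignedMeasure.integrable_rnDeriv s τ) hE,
    SignedMeasure.withDensityᵥ_rnDeriv_eq s τ hsac, hs E hE]

theorem exists_scalar_density (τ : Measure X) [SigmaFinite τ] (g : Set X → 𝕜)
    (hadd : ∀ E : ℕ → Set X, (∀ i, MeasurableSet (E i)) → Pairwise (Function.onFun Disjoint E) →
      HasSum (fun i => g (E i)) (g (⋃ i, E i)))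
    (hac : ∀ E, MeasurableSet E → τ E = 0 → g E = 0) :
    ∃ h : X → 𝕜, Measurable h ∧ Integrable h τ ∧ ∀ E, MeasurableSet E → ∫ x in E, h x ∂τ = g E := by
  obtain ⟨a, ham, hai, ha⟩ := exists_real_density τ (fun E => RCLike.re (g E))
    (fun E hE hd => RCLike.hasSum_re 𝕜 (hadd E hE hd)) (fun E hE h0 => by simp [hac E hE h0])
  obtain ⟨b, hbm, hbi, hb⟩ := exists_real_density τ (fun E => RCLike.im (g E))
    (fun E hE hd => RCLike.hasSum_im 𝕜 (hadd E hE hd)) (fun E hE h0 => by simp [hac E hE h0])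
  refine ⟨fun x => (a x : 𝕜) + (b x : 𝕜) * RCLike.I, ?_, ?_, fun E hE => ?_⟩
  · exact (RCLike.measurable_ofReal.comp ham).add
      ((RCLike.measurable_ofReal.comp hbm).mul_const _)
  · exact hai.ofReal.add (hbi.ofReal.mul_const _)
  · have h1 : Integrable (fun x => (a x : 𝕜)) (τ.restrict E) := hai.ofReal.restrict
    have h2 : Integrable (fun x => (b x : 𝕜) * RCLike.I) (τ.restrict E) :=
      (hbi.ofReal.mul_const _).restrict
    rw [integral_add h1 h2, integral_mul_const, integral_ofReal, integral_ofReal, ha E hE, hb E hE, RCLike.re_add_im]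

theorem apply_eq_zero {G : Set X} (hG : G ∈ 𝓕.ring) (h : W.traceMeasure G = 0) : W G = 0 := by
  rw [W.traceMeasure_apply hG, ENNReal.ofReal_eq_zero] at h
  have h1 := RCLike.nonneg_iff.1 (W.posSemidef G hG).trace_nonneg
  refine (W.posSemidef G hG).trace_eq_zero_iff.1 (RCLike.ext ?_ ?_)
  · rw [map_zero]; exact le_antisymm h h1.1
  · rw [map_zero]; exact h1.2

theorem norm_mulVec_sq_le {M : Matrix (Fin d) (Fin d) 𝕜} (hM : M.PosSemidef) (v : Fin d → 𝕜) :
    ∑ j, ‖M.mulVec v j‖ ^ 2 ≤ RCLike.re M.trace * RCLike.re (star v ⬝ᵥ M.mulVec v) := by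
  obtain ⟨B, rfl⟩ : ∃ B : Matrix (Fin d) (Fin d) 𝕜, M = B.conjTranspose * B := by
    open scoped MatrixOrder in
    exact CStarAlgebra.nonneg_iff_eq_star_mul_self.1 (Matrix.nonneg_iff_posSemidef.2 hM)
  have h1 : RCLike.re (B.conjTranspose * B).trace = ∑ j, ∑ i, ‖B i j‖ ^ 2 := by
    simp only [Matrix.trace, Matrix.diag, Matrix.mul_apply, Matrix.conjTranspose_apply, map_sum,
      RCLike.star_def, RCLike.conj_mul]
    norm_cast
  have h2 : RCLike.re (star v ⬝ᵥ (B.conjTranspose * B).mulVec v) =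
      ∑ i, ‖B.mulVec v i‖ ^ 2 := by
    rw [← Matrix.mulVec_mulVec, Matrix.dotProduct_mulVec, ← Matrix.star_mulVec]
    simp only [dotProduct, Pi.star_apply, map_sum, RCLike.star_def, RCLike.conj_mul]
    norm_cast
  rw [h1, h2, Finset.sum_mul]
  refine Finset.sum_le_sum fun j _ => ?_
  rw [← Matrix.mulVec_mulVec]
  have h3 : ‖B.conjTranspose.mulVec (B.mulVec v) j‖ ≤ ∑ i, ‖B i j‖ * ‖B.mulVec v i‖ := by
    refine (norm_sum_le Finset.univ fun i => B.conjTranspose j i * B.mulVec v i).trans_eq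
      (Finset.sum_congr rfl fun i _ => ?_)
    rw [norm_mul, Matrix.conjTranspose_apply, norm_star]
  exact (pow_le_pow_left₀ (norm_nonneg _) h3 2).trans (Finset.sum_mul_sq_le_sq_mul_sq _ _ _)

theorem norm_apply_le {M : Matrix (Fin d) (Fin d) 𝕜} (hM : M.PosSemidef) (j k : Fin d) :
    ‖M j k‖ ≤ RCLike.re M.trace := by
  have h := norm_mulVec_sq_le hM (Pi.single k 1)
  have h1 : ∀ i, 0 ≤ RCLike.re (M i i) := fun i => (RCLike.nonneg_iff.1 hM.diag_nonneg).1
  have h2 : RCLike.re (M k k) ≤ RCLike.re M.trace := by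
    rw [Matrix.trace, map_sum]
    exact Finset.single_le_sum (f := fun i => RCLike.re (M i i)) (fun i _ => h1 i)
      (Finset.mem_univ k)
  have h3 : star (Pi.single k (1 : 𝕜)) ⬝ᵥ M.mulVec (Pi.single k 1) = M k k := by
    rw [← Pi.single_star]; simp
  rw [h3] at h
  have h4 : ‖M j k‖ ^ 2 ≤ ∑ i, ‖M.mulVec (Pi.single k 1) i‖ ^ 2 := by
    have := Finset.single_le_sum (f := fun i => ‖M.mulVec (Pi.single k 1) i‖ ^ 2)
      (fun i _ => by positivity) (Finset.mem_univ j)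
    simpa using this
  have h5 := (h1 k).trans h2
  refine le_of_sq_le_sq (h4.trans (h.trans ?_)) h5
  rw [sq]; exact mul_le_mul_of_nonneg_left h2 h5

theorem ae_posSemidef (τ : Measure X) (w : X → Matrix (Fin d) (Fin d) 𝕜)
    (hi : ∀ j k, Integrable (fun x => w x j k) τ) (V : Set X → Matrix (Fin d) (Fin d) 𝕜)
    (hV : ∀ E, MeasurableSet E → (V E).PosSemidef)
    (h : ∀ E, MeasurableSet E → ∀ j k, ∫ x in E, w x j k ∂τ = V E j k) :
    ∀ᵐ x ∂τ, (w x).PosSemidef := by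
  have hherm : ∀ᵐ x ∂τ, ∀ j k, star (w x k j) = w x j k := by
    rw [ae_all_iff]; intro j; rw [ae_all_iff]; intro k
    refine Integrable.ae_eq_of_forall_setIntegral_eq _ _ ?_ (hi j k) fun E hE _ => ?_
    · exact (RCLike.conjCLE (K := 𝕜)).toContinuousLinearMap.integrable_comp (hi k j)
    · rw [h E hE]
      have := integral_conj (μ := τ.restrict E) (f := fun x => w x k j)
      simp only [RCLike.star_def]
      rw [this, h E hE, ← RCLike.star_def]
      exact (hV E hE).1.apply j k
  have hq : ∀ v : Fin d → 𝕜, ∀ᵐ x ∂τ, 0 ≤ RCLike.re (star v ⬝ᵥ (w x).mulVec v) := by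
    intro v
    have hint : ∀ E, MeasurableSet E → Integrable (fun x => star v ⬝ᵥ (w x).mulVec v)
        (τ.restrict E) ∧
        ∫ x in E, star v ⬝ᵥ (w x).mulVec v ∂τ = star v ⬝ᵥ (V E).mulVec v := by
      intro E hE
      have hi' : ∀ j k, Integrable (fun x => w x j k) (τ.restrict E) :=
        fun j k => (hi j k).restrict
      simp only [dotProduct, Matrix.mulVec]
      have hin : ∀ j, Integrable (fun x => ∑ k, w x j k * v k) (τ.restrict E) :=
        fun j => integrable_finsetSum _ fun k _ => (hi' j k).mul_const _
      refine ⟨integrable_finsetSum _ fun j _ => (hin j).const_mul _, ?_⟩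
      rw [integral_finsetSum _ fun j _ => (hin j).const_mul _]
      refine Finset.sum_congr rfl fun j _ => ?_
      rw [integral_const_mul, integral_finsetSum _ fun k _ => (hi' j k).mul_const _]
      congr 1
      refine Finset.sum_congr rfl fun k _ => ?_
      rw [integral_mul_const, h E hE]
    refine ae_nonneg_of_forall_setIntegral_nonneg ?_ fun E hE _ => ?_
    · simpa using (hint Set.univ MeasurableSet.univ).1.re
    · rw [integral_re (hint E hE).1, (hint E hE).2]
      exact (RCLike.nonneg_iff.1 ((hV E hE).dotProduct_mulVec_nonneg v)).1
  have hq' : ∀ᵐ x ∂τ, ∀ n, 0 ≤ RCLike.re (star (TopologicalSpace.denseSeq (Fin d → 𝕜) n) ⬝ᵥ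
      (w x).mulVec (TopologicalSpace.denseSeq (Fin d → 𝕜) n)) :=
    ae_all_iff.2 fun n => hq _
  filter_upwards [hherm, hq'] with x hx hx'
  have hH : (w x).IsHermitian := Matrix.IsHermitian.ext hx
  refine Matrix.PosSemidef.of_dotProduct_mulVec_nonneg hH fun v => ?_
  refine RCLike.nonneg_iff.2 ⟨?_, hH.im_star_dotProduct_mulVec_self v⟩
  refine (TopologicalSpace.denseRange_denseSeq (Fin d → 𝕜)).induction_on
    (p := fun v => 0 ≤ RCLike.re (star v ⬝ᵥ (w x).mulVec v)) v ?_ hx'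
  exact isClosed_le continuous_const (by fun_prop)

theorem exists_isDensity : ∃ w, W.IsDensity w := by
  classical
  have := W.sigmaFinite_traceMeasure
  set τ := W.traceMeasure with hτ
  have : Countable (𝓕.atoms 0) := (𝓕.countable_atoms 0).to_subtype
  have hloc : ∀ I : 𝓕.atoms 0, ∃ w : X → Matrix (Fin d) (Fin d) 𝕜,
      (∀ j k, Measurable fun x => w x j k) ∧ (∀ x, (w x).PosSemidef) ∧
      (∀ j k, Integrable (fun x => w x j k) τ) ∧
      ∀ E, MeasurableSet E → ∀ j k, ∫ x in E, w x j k ∂τ = W (E ∩ I) j k := by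
    intro I
    have h1 : ∀ j k, ∃ h : X → 𝕜, Measurable h ∧ Integrable h τ ∧
        ∀ E, MeasurableSet E → ∫ x in E, h x ∂τ = W (E ∩ I) j k := by
      intro j k
      refine exists_scalar_density τ (fun E => W (E ∩ I) j k) (fun E hE hd => ?_)
        fun E hE h0 => ?_
      · have h2 := W.hasSum_inter (𝓕.mem_ring I.2) hE hd
        exact Pi.hasSum.1 (Pi.hasSum.1 h2 j) k
      · rw [W.apply_eq_zero (𝓕.inter_mem_ring hE I.2)
          (measure_mono_null Set.inter_subset_left h0)]
        rfl
    choose h hm hi hh using h1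
    have hae := ae_posSemidef τ (fun x => Matrix.of fun j k => h j k x) hi
      (fun E => W (E ∩ I)) (fun E hE => W.posSemidef _ (𝓕.inter_mem_ring hE I.2))
      (fun E hE j k => hh j k E hE)
    obtain ⟨N, hN, hNm, hN0⟩ := exists_measurable_superset_of_null (ae_iff.1 hae)
    have hNae : ∀ᵐ x ∂τ, x ∉ N := measure_eq_zero_iff_ae_notMem.1 hN0
    have heq : ∀ j k, (fun x => (if x ∈ N then (0 : Matrix (Fin d) (Fin d) 𝕜) else
        Matrix.of fun j k => h j k x) j k) =ᵐ[τ] h j k := by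
      intro j k
      filter_upwards [hNae] with x hx
      simp [hx]
    refine ⟨fun x => if x ∈ N then 0 else Matrix.of fun j k => h j k x, fun j k => ?_,
      fun x => ?_, fun j k => ?_, fun E hE j k => ?_⟩
    · have : (fun x => (if x ∈ N then (0 : Matrix (Fin d) (Fin d) 𝕜) else
          Matrix.of fun j k => h j k x) j k) = fun x => if x ∈ N then 0 else h j k x := by
        funext x; split_ifs <;> rfl
      rw [this]
      exact Measurable.ite hNm measurable_const (hm j k)
    · by_cases hx : x ∈ N
      · simpa [hx] using Matrix.PosSemidef.zero
      · simp only [hx, if_false]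
        by_contra hcon
        exact hx (hN hcon)
    · exact (hi j k).congr (heq j k).symm
    · rw [integral_congr_ae (ae_restrict_of_ae (heq j k)), hh j k E hE]
  choose wI hwm hwp hwi hwe using hloc
  have hglue : ∃ w : X → Matrix (Fin d) (Fin d) 𝕜, (∀ j k, Measurable fun x => w x j k) ∧
      ∀ I : 𝓕.atoms 0, Set.EqOn w (wI I) I := by
    rcases isEmpty_or_nonempty (𝓕.atoms 0) with hE | hE
    · exact ⟨0, fun j k => measurable_const, fun I => hE.elim I⟩
    · let _ : MeasurableSpace (Matrix (Fin d) (Fin d) 𝕜) := MeasurableSpace.pi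
      obtain ⟨w, hw, hw'⟩ := exists_measurable_piecewise (fun I : 𝓕.atoms 0 => (I : Set X))
        (fun I => 𝓕.measurableSet_of_mem_atoms I.2) wI
        (fun I => measurable_pi_iff.2 fun j => measurable_pi_iff.2 fun k => hwm I j k)
        (fun I J hIJ x hx => (Set.disjoint_left.1 (disjoint_atoms 0 hIJ) hx.1 hx.2).elim)
      exact ⟨w, fun j k => measurable_pi_iff.1 (measurable_pi_iff.1 hw j) k, hw'⟩
  obtain ⟨w, hw, hwI⟩ := hglue
  have hps : ∀ x, (w x).PosSemidef := by
    intro x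
    have hx : x ∈ ⋃ I : 𝓕.atoms 0, (I : Set X) := by rw [iUnion_atoms]; trivial
    obtain ⟨I, hI⟩ := Set.mem_iUnion.1 hx
    rw [hwI I hI]; exact hwp I x
  have hdec : ∀ E, E = ⋃ I : 𝓕.atoms 0, (I : Set X) ∩ E := by
    intro E; rw [← Set.iUnion_inter, iUnion_atoms, Set.univ_inter]
  have hdisj : ∀ E : Set X, Pairwise (Function.onFun Disjoint
      fun I : 𝓕.atoms 0 => (I : Set X) ∩ E) := fun E I J h =>
    (disjoint_atoms 0 h).mono Set.inter_subset_left Set.inter_subset_left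
  have hIint : ∀ (I : 𝓕.atoms 0) (E : Set X), MeasurableSet E → ∀ j k,
      IntegrableOn (fun x => w x j k) ((I : Set X) ∩ E) τ ∧
      ∫ x in (I : Set X) ∩ E, w x j k ∂τ = W ((I : Set X) ∩ E) j k := by
    intro I E hE j k
    have hm : MeasurableSet ((I : Set X) ∩ E) := (𝓕.measurableSet_of_mem_atoms I.2).inter hE
    have heq : Set.EqOn (fun x => wI I x j k) (fun x => w x j k) ((I : Set X) ∩ E) :=
      fun x hx => congrArg (fun M => M j k) (hwI I hx.1).symm
    refine ⟨((hwi I j k).integrableOn).congr_fun heq hm, ?_⟩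
    rw [← setIntegral_congr_fun hm heq, hwe I _ hm]
    congr 1
    rw [Set.inter_right_comm, Set.inter_self]
  -- The trace of the density is `1` almost everywhere.
  have htr : ∀ᵐ x ∂τ, RCLike.re (w x).trace = 1 := by
    have hall : ∀ I : 𝓕.atoms 0, ∀ᵐ x ∂(τ.restrict I), RCLike.re (w x).trace = 1 := by
      intro I
      have hfin : τ (I : Set X) < ⊤ := by
        rw [hτ, W.traceMeasure_apply (𝓕.mem_ring I.2)]; exact ENNReal.ofReal_lt_top
      have : IsFiniteMeasure (τ.restrict (I : Set X)) := ⟨by simpa using hfin⟩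
      have hIm := 𝓕.measurableSet_of_mem_atoms I.2
      have hti : ∀ E, MeasurableSet E →
          Integrable (fun x => (w x).trace) (τ.restrict ((I : Set X) ∩ E)) := fun E hE =>
        integrable_finsetSum _ fun j _ => (hIint I E hE j j).1
      have hti' : Integrable (fun x => (w x).trace) (τ.restrict (I : Set X)) := by
        simpa using hti Set.univ MeasurableSet.univ
      refine Integrable.ae_eq_of_forall_setIntegral_eq _ _ hti'.re (integrable_const (1 : ℝ))
        fun E hE _ => ?_
      rw [Measure.restrict_restrict hE, Set.inter_comm, integral_re (hti E hE)]
      have : ∫ x in (I : Set X) ∩ E, (w x).trace ∂τ = (W ((I : Set X) ∩ E)).trace := by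
        simp only [Matrix.trace, Matrix.diag]
        rw [integral_finsetSum _ fun j _ => (hIint I E hE j j).1]
        exact Finset.sum_congr rfl fun j _ => (hIint I E hE j j).2
      rw [this, setIntegral_const, smul_eq_mul, mul_one, Measure.real, hτ,
        W.traceMeasure_apply (𝓕.inter_mem_ring_left (G := E ∩ I) ?_ hIm |> fun h => ?_),
        ENNReal.toReal_ofReal]
      · exact W.re_trace_nonneg (Set.inter_comm E I ▸ 𝓕.inter_mem_ring hE I.2)
      · exact 𝓕.inter_mem_ring hE I.2
      · exact Set.inter_comm E I ▸ 𝓕.inter_mem_ring hE I.2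
    have := (ae_restrict_iUnion_iff (μ := τ) (fun I : 𝓕.atoms 0 => (I : Set X))
      (fun x => RCLike.re (w x).trace = 1)).2 hall
    rwa [iUnion_atoms, Measure.restrict_univ] at this
  have hbound : ∀ᵐ x ∂τ, ∀ j k, ‖w x j k‖ ≤ 1 := by
    filter_upwards [htr] with x hx j k using hx ▸ norm_apply_le (hps x) j k
  have hint : ∀ E ∈ 𝓕.ring, ∀ j k, IntegrableOn (fun x => w x j k) E τ := by
    intro E hE j k
    have hfin : τ E < ⊤ := by
      rw [hτ, W.traceMeasure_apply hE]; exact ENNReal.ofReal_lt_top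
    refine Measure.integrableOn_of_bounded (M := 1) hfin.ne (hw j k).aestronglyMeasurable ?_
    filter_upwards [ae_restrict_of_ae hbound] with x hx using hx j k
  refine ⟨w, hw, hps, hint, fun E hE j k => ?_⟩
  have hEm := 𝓕.measurableSet_of_mem_ring hE
  have hmI : ∀ I : 𝓕.atoms 0, MeasurableSet ((I : Set X) ∩ E) :=
    fun I => (𝓕.measurableSet_of_mem_atoms I.2).inter hEm
  have hs1 := hasSum_integral_iUnion hmI (hdisj E) (by rw [← hdec E]; exact hint E hE j k)
  rw [← hdec E] at hs1
  have hs2 := W.hasSum_inter hE (E := fun I : 𝓕.atoms 0 => (I : Set X))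
    (fun I => 𝓕.measurableSet_of_mem_atoms I.2) (disjoint_atoms 0)
  rw [iUnion_atoms, Set.univ_inter] at hs2
  have hs3 := Pi.hasSum.1 (Pi.hasSum.1 hs2 j) k
  rw [show (fun I : 𝓕.atoms 0 => ∫ x in (I : Set X) ∩ E, w x j k ∂τ) =
    fun I : 𝓕.atoms 0 => W ((I : Set X) ∩ E) j k from
    funext fun I => (hIint I E hEm j k).2] at hs1
  exact hs1.unique hs3

/-- The density `dW/d(tr W)`, unique up to a null set of `tr W`. -/
noncomputable def density : X → Matrix (Fin d) (Fin d) 𝕜 := W.exists_isDensity.choose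

theorem isDensity_density : W.IsDensity W.density := W.exists_isDensity.choose_spec

/-- `‖f‖²_{L²(W)} = ∫ ⟨W(dx) f(x), f(x)⟩`, an element of `[0, ∞]`. Writing `W = w d(tr W)`, the
integrand `⟨w(x) f(x), f(x)⟩` is nonnegative. -/
noncomputable def normSq (f : X → EuclideanSpace 𝕜 (Fin d)) : ℝ≥0∞ :=
  ∫⁻ x, ENNReal.ofReal (RCLike.re (inner 𝕜 (f x) (Matrix.toEuclideanLin (W.density x) (f x))))
    ∂W.traceMeasure

/-- `f` belongs to `L²(W)` (as a function; functions of norm `0` are not divided out). -/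
def MemL2 (f : X → EuclideanSpace 𝕜 (Fin d)) : Prop :=
  Measurable f ∧ W.normSq f < ∞

/-- `∫_E W(dx) f(x)`, that is `∫_E w(x) f(x) d(tr W)(x)` with `W = w d(tr W)`. -/
noncomputable def integral (E : Set X) (f : X → EuclideanSpace 𝕜 (Fin d)) :
    EuclideanSpace 𝕜 (Fin d) :=
  ∫ x in E, Matrix.toEuclideanLin (W.density x) (f x) ∂W.traceMeasure

/-- For `f` in `L²(W)` and `E` in `F₀` the integral `∫_E W(dx) f(x)` converges absolutely. -/
theorem integrableOn_of_memL2 {f : X → EuclideanSpace 𝕜 (Fin d)} (hf : W.MemL2 f) {E : Set X}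
    (hE : E ∈ 𝓕.ring) :
    IntegrableOn (fun x => Matrix.toEuclideanLin (W.density x) (f x)) E W.traceMeasure := by
  have hw := W.isDensity_density
  have hfj : ∀ j, Measurable fun x => f x j := fun j => by
    have := hf.1
    fun_prop
  have hmeas : ∀ j, Measurable fun x => Matrix.toEuclideanLin (W.density x) (f x) j := by
    intro j
    simp only [Matrix.toLpLin_apply, Matrix.mulVec, dotProduct]
    exact Finset.measurable_sum _ fun k _ => (hw.measurable j k).mul (hfj k)
  have hm : Measurable fun x => Matrix.toEuclideanLin (W.density x) (f x) := by
    refine (PiLp.continuous_toLp 2 (fun _ : Fin d => 𝕜)).measurable.comp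
      (g := WithLp.toLp 2) (f := fun x => (Matrix.toEuclideanLin (W.density x) (f x)).ofLp) ?_
    exact measurable_pi_iff.2 hmeas
  have hinner : ∀ x, inner 𝕜 (f x) (Matrix.toEuclideanLin (W.density x) (f x)) =
      star (f x).ofLp ⬝ᵥ (W.density x).mulVec (f x).ofLp := by
    intro x
    rw [EuclideanSpace.inner_eq_star_dotProduct, dotProduct_comm]
    rfl
  have hq0 : ∀ x, 0 ≤ RCLike.re
      (inner 𝕜 (f x) (Matrix.toEuclideanLin (W.density x) (f x))) := by
    intro x
    rw [hinner]
    exact (RCLike.nonneg_iff.1 ((hw.posSemidef x).dotProduct_mulVec_nonneg _)).1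
  have hqi : Integrable (fun x => RCLike.re
      (inner 𝕜 (f x) (Matrix.toEuclideanLin (W.density x) (f x)))) W.traceMeasure := by
    refine ⟨(RCLike.measurable_re.comp (hf.1.inner hm)).aestronglyMeasurable, ?_⟩
    rw [hasFiniteIntegral_iff_ofReal (Filter.Eventually.of_forall hq0)]
    exact hf.2
  have hti : IntegrableOn (fun x => RCLike.re (W.density x).trace) E W.traceMeasure :=
    Integrable.re (integrable_finsetSum _ fun j _ => hw.integrableOn E hE j j)
  refine Integrable.mono' (hti.add hqi.integrableOn) hm.aestronglyMeasurable
    (Filter.Eventually.of_forall fun x => ?_)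
  have h1 := norm_mulVec_sq_le (hw.posSemidef x) (f x).ofLp
  rw [← hinner] at h1
  have h2 : ‖Matrix.toEuclideanLin (W.density x) (f x)‖ ^ 2 =
      ∑ j, ‖(W.density x).mulVec (f x).ofLp j‖ ^ 2 := EuclideanSpace.norm_sq_eq _
  rw [← h2] at h1
  have h3 := (RCLike.nonneg_iff.1 (hw.posSemidef x).trace_nonneg).1
  have h4 := hq0 x
  simp only [Pi.add_apply]
  refine le_of_sq_le_sq (h1.trans ?_) (add_nonneg h3 h4)
  nlinarith

/-- The embedding
`∑_{I ∈ 𝒟} ‖A_I^{1/2} ∫_I W(dx) f(x)‖² ≤ a ‖f‖²_{L²(W)}` for all `f` in `L²(W)`; the sum runs over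
all atoms of all generations and is a sum in `[0, ∞]`. -/
def Embedding (A : 𝓕.Atom → Matrix (Fin d) (Fin d) 𝕜) (a : ℝ≥0) : Prop :=
  ∀ f : X → EuclideanSpace 𝕜 (Fin d), W.MemL2 f →
    ∑' I : 𝓕.Atom, ENNReal.ofReal
      (‖Matrix.toEuclideanLin (psdSqrt (A I)) (W.integral I.carrier f)‖ ^ 2) ≤ a * W.normSq f

/-- The testing condition `∑_{I ⊂ I₀} W(I) A_I W(I) ≤ b W(I₀)` for all atoms `I₀`, in the order of
Hermitian matrices; convergence of the sum is part of the condition. -/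
def Testing (A : 𝓕.Atom → Matrix (Fin d) (Fin d) 𝕜) (b : ℝ≥0) : Prop :=
  ∀ I₀ : 𝓕.Atom,
    Summable (fun I : {I : 𝓕.Atom // I.Sub I₀} => W I.1.carrier * A I.1 * W I.1.carrier) ∧
    ((b : ℝ) • W I₀.carrier -
      ∑' I : {I : 𝓕.Atom // I.Sub I₀}, W I.1.carrier * A I.1 * W I.1.carrier).PosSemidef

end MatrixMeasure

/-!
The proof is by a Bellman function combined with polynomial interpolation in a parameter.

Write `f_I = ∫_I W(dx) f(x)` and let `M(I) = ∑_{K ⊂ I} W(K) A_K W(K)` be the sum of the testing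
condition, so that `M(I) ≤ b W(I)`. For `s ≥ 0` consider
`q_s(I) = ⟨(W(I) + s M(I))⁻¹ f_I, f_I⟩ = max_u (2 Re ⟨f_I, u⟩ - ⟨(W(I) + s M(I)) u, u⟩)`.
Since `f_I`, `W(I)` are additive and `M(I) - W(I) A_I W(I)` is the sum of `M(J)` over the children
`J` of `I`, inserting the maximizer `v_s(I)` of `I` in the forms of the children gives
`q_s(I) + s ‖A_I^{1/2} W(I) v_s(I)‖² ≤ ∑_J q_s(J)`, while `q_s(I) ≤ ∫_I ⟨W(dx) f, f⟩` follows from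
`⟨w (f - u), f - u⟩ ≥ 0` (`Testing.bellman_add_le`). Telescoping over the generations
(`tsum_le_of_add_le_tsum_children`) bounds `s ∑_I ‖A_I^{1/2} W(I) v_s(I)‖²` by `‖f‖²`.

It remains to pass from `W(I) v_s(I)` to its value `f_I` at `s = 0`. Diagonalizing `W(I)` and `M(I)`
simultaneously gives `W(I) v_s(I) = ∑_i (1 + s λ_i)⁻¹ y_i` with `0 ≤ λ_i ≤ b` and `∑_i y_i = f_I`, so
`∏_j (1 + s λ_j) • W(I) v_s(I)` is a polynomial in `s` of degree less than `d` with the value `f_I`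
at `0`. Lagrange interpolation at the nodes `s = 1 / b, …, d / b` represents `f_I` by the vectors
`W(I) v_s(I)` with weights bounded in terms of `d` alone (`exists_resolvent_interpolation`). The
matrices `W(I)` may be singular, but `f_I` always lies in the range of `W(I)`
(`exists_toEuclideanLin_eq_integral`).

Conversely, the functions `1_{I₀} v` turn the embedding into the testing condition with the same
constant (`Embedding.testing`). Least constants exist since both sets of constants are closed.
-/

/-! ### Quadratic forms of matrices -/

section LinearAlgebra

variable {𝕜 : Type*} [RCLike 𝕜] {d : ℕ}

open Matrix

/-- The real number `⟨M v, v⟩`. -/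
noncomputable def quadForm (M : Matrix (Fin d) (Fin d) 𝕜) (v : EuclideanSpace 𝕜 (Fin d)) : ℝ :=
  RCLike.re (inner 𝕜 v (toEuclideanLin M v))

theorem inner_toEuclideanLin_eq (M : Matrix (Fin d) (Fin d) 𝕜) (v u : EuclideanSpace 𝕜 (Fin d)) :
    inner 𝕜 v (toEuclideanLin M u) = star v.ofLp ⬝ᵥ M *ᵥ u.ofLp := by
  rw [EuclideanSpace.inner_eq_star_dotProduct, dotProduct_comm]
  rfl

theorem quadForm_nonneg {M : Matrix (Fin d) (Fin d) 𝕜} (hM : M.PosSemidef)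
    (v : EuclideanSpace 𝕜 (Fin d)) : 0 ≤ quadForm M v := by
  rw [quadForm, inner_toEuclideanLin_eq]
  exact (RCLike.nonneg_iff.1 (hM.dotProduct_mulVec_nonneg _)).1

theorem inner_toEuclideanLin_left {M : Matrix (Fin d) (Fin d) 𝕜} (hM : M.IsHermitian)
    (v u : EuclideanSpace 𝕜 (Fin d)) :
    inner 𝕜 (toEuclideanLin M v) u = inner 𝕜 v (toEuclideanLin M u) :=
  isSymmetric_toEuclideanLin_iff.2 hM v u

theorem toEuclideanLin_mul_apply (M N : Matrix (Fin d) (Fin d) 𝕜)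
    (v : EuclideanSpace 𝕜 (Fin d)) :
    toEuclideanLin (M * N) v = toEuclideanLin M (toEuclideanLin N v) := by
  rw [toLpLin_mul_same]; rfl

theorem posSemidef_of_quadForm_nonneg {M : Matrix (Fin d) (Fin d) 𝕜} (hM : M.IsHermitian)
    (h : ∀ v, 0 ≤ quadForm M v) : M.PosSemidef := by
  rw [← isPositive_toEuclideanLin_iff]
  refine ⟨isSymmetric_toEuclideanLin_iff.2 hM, fun v => ?_⟩
  rw [inner_toEuclideanLin_left hM]
  exact h v

theorem quadForm_add (M N : Matrix (Fin d) (Fin d) 𝕜) (v : EuclideanSpace 𝕜 (Fin d)) :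
    quadForm (M + N) v = quadForm M v + quadForm N v := by
  simp [quadForm, inner_add_right]

theorem quadForm_sub (M N : Matrix (Fin d) (Fin d) 𝕜) (v : EuclideanSpace 𝕜 (Fin d)) :
    quadForm (M - N) v = quadForm M v - quadForm N v := by
  simp [quadForm, inner_sub_right]

theorem toEuclideanLin_real_smul (r : ℝ) (M : Matrix (Fin d) (Fin d) 𝕜)
    (v : EuclideanSpace 𝕜 (Fin d)) :
    toEuclideanLin (r • M) v = (r : 𝕜) • toEuclideanLin M v := by
  rw [RCLike.real_smul_eq_coe_smul (K := 𝕜), map_smul]; rfl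

theorem quadForm_smul (r : ℝ) (M : Matrix (Fin d) (Fin d) 𝕜) (v : EuclideanSpace 𝕜 (Fin d)) :
    quadForm (r • M) v = r * quadForm M v := by
  rw [quadForm, toEuclideanLin_real_smul, inner_smul_right, RCLike.re_ofReal_mul]; rfl

theorem hasSum_quadForm {ι : Type*} {M : ι → Matrix (Fin d) (Fin d) 𝕜}
    {N : Matrix (Fin d) (Fin d) 𝕜} (h : HasSum M N) (v : EuclideanSpace 𝕜 (Fin d)) :
    HasSum (fun i => quadForm (M i) v) (quadForm N v) := by
  let φ : Matrix (Fin d) (Fin d) 𝕜 →+ ℝ :=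
    { toFun := fun M => quadForm M v
      map_zero' := by simp [quadForm]
      map_add' := fun M N => quadForm_add M N v }
  refine h.map φ ?_
  change Continuous fun M : Matrix (Fin d) (Fin d) 𝕜 => quadForm M v
  simp only [quadForm, inner_toEuclideanLin_eq]
  fun_prop

theorem norm_psdSqrt_sq {M : Matrix (Fin d) (Fin d) 𝕜} (hM : M.PosSemidef)
    (v : EuclideanSpace 𝕜 (Fin d)) :
    ‖toEuclideanLin (psdSqrt M) v‖ ^ 2 = quadForm M v := by
  open scoped MatrixOrder in
  have h0 : (0 : Matrix (Fin d) (Fin d) 𝕜) ≤ M := Matrix.nonneg_iff_posSemidef.2 hM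
  have h1 : psdSqrt M * psdSqrt M = M := CFC.sqrt_mul_sqrt_self M h0
  have h2 : (psdSqrt M).PosSemidef := Matrix.nonneg_iff_posSemidef.1 (CFC.sqrt_nonneg M)
  rw [quadForm]
  conv_rhs => rw [← h1, toEuclideanLin_mul_apply, ← inner_toEuclideanLin_left h2.1]
  rw [inner_self_eq_norm_sq]

theorem quadForm_mul_mul {W : Matrix (Fin d) (Fin d) 𝕜} (hW : W.IsHermitian)
    (M : Matrix (Fin d) (Fin d) 𝕜) (v : EuclideanSpace 𝕜 (Fin d)) :
    quadForm (W * M * W) v = quadForm M (toEuclideanLin W v) := by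
  rw [quadForm, toEuclideanLin_mul_apply, toEuclideanLin_mul_apply,
    ← inner_toEuclideanLin_left hW, quadForm]

theorem toEuclideanLin_eq_zero_of_quadForm {M : Matrix (Fin d) (Fin d) 𝕜} (hM : M.PosSemidef)
    {v : EuclideanSpace 𝕜 (Fin d)} (h : quadForm M v = 0) : toEuclideanLin M v = 0 := by
  rw [← norm_psdSqrt_sq hM, sq_eq_zero_iff, norm_eq_zero] at h
  open scoped MatrixOrder in
  have h1 : psdSqrt M * psdSqrt M = M :=
    CFC.sqrt_mul_sqrt_self M (Matrix.nonneg_iff_posSemidef.2 hM)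
  rw [← h1, toEuclideanLin_mul_apply, h, map_zero]

theorem quadForm_sub_vec {M : Matrix (Fin d) (Fin d) 𝕜} (hM : M.IsHermitian)
    (u v : EuclideanSpace 𝕜 (Fin d)) :
    quadForm M (u - v) =
      quadForm M u - 2 * RCLike.re (inner 𝕜 (toEuclideanLin M u) v) + quadForm M v := by
  have h : RCLike.re (inner 𝕜 v (toEuclideanLin M u)) =
    RCLike.re (inner 𝕜 (toEuclideanLin M u) v) := inner_re_symm _ _
  simp only [quadForm, map_sub, inner_sub_left, inner_sub_right, h]
  rw [← inner_toEuclideanLin_left hM u v]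
  ring

/-- If `S v = f`, then `⟨f, v⟩` is the maximum over `u` of `2 Re ⟨f, u⟩ - ⟨S u, u⟩`. -/
theorem two_mul_re_inner_sub_quadForm_le {S : Matrix (Fin d) (Fin d) 𝕜} (hS : S.PosSemidef)
    {f v : EuclideanSpace 𝕜 (Fin d)} (h : toEuclideanLin S v = f)
    (u : EuclideanSpace 𝕜 (Fin d)) :
    2 * RCLike.re (inner 𝕜 f u) - quadForm S u ≤ RCLike.re (inner 𝕜 f v) := by
  have h1 := quadForm_nonneg hS (v - u)
  have h2 : quadForm S v = RCLike.re (inner 𝕜 f v) := by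
    rw [quadForm, h]; exact inner_re_symm _ _
  rw [quadForm_sub_vec hS.1, h, h2] at h1
  linarith

/-! ### Simultaneous diagonalization -/

/-- A square root `R` of `W` and a Moore–Penrose inverse `P` of `R`. -/
theorem exists_sqrt_pinv {W : Matrix (Fin d) (Fin d) 𝕜} (hW : W.PosSemidef) :
    ∃ R P : Matrix (Fin d) (Fin d) 𝕜, R.IsHermitian ∧ P.IsHermitian ∧ R * R = W ∧
      P * R = R * P ∧ R * P * R = R ∧ P * R * P = P := by
  have hc : ∀ g : ℝ → ℝ, ContinuousOn g (spectrum ℝ W) := fun g =>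
    (Matrix.finite_real_spectrum (A := W)).continuousOn g
  have hsa : IsSelfAdjoint W := hW.1
  have hR : cfc (fun x : ℝ => √x) W * cfc (fun x : ℝ => √x) W = W := by
    rw [← cfc_mul _ _ W (hc _) (hc _)]
    conv_rhs => rw [← cfc_id ℝ W]
    refine cfc_congr fun x hx => ?_
    have hx0 : 0 ≤ x := by
      open scoped MatrixOrder in
      exact spectrum_nonneg_of_nonneg (Matrix.nonneg_iff_posSemidef.2 hW) hx
    simp [Real.mul_self_sqrt hx0]
  refine ⟨cfc (fun x : ℝ => √x) W, cfc (fun x : ℝ => (√x)⁻¹) W,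
    cfc_predicate (R := ℝ) (p := IsSelfAdjoint) _ W,
    cfc_predicate (R := ℝ) (p := IsSelfAdjoint) _ W, hR, cfc_commute_cfc _ _ W, ?_, ?_⟩
  · simp only [← cfc_mul _ _ W (hc _) (hc _)]
    refine cfc_congr fun x hx => ?_
    by_cases h : √x = 0
    · simp [h]
    · field_simp
  · simp only [← cfc_mul _ _ W (hc _) (hc _)]
    refine cfc_congr fun x hx => ?_
    by_cases h : √x = 0
    · simp [h]
    · field_simp

/-- Simultaneous diagonalization by congruence of `W` and a form `M` dominated by a multiple of `W`;
`W` may be singular. -/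
theorem exists_simultaneous_diagonalization {W M : Matrix (Fin d) (Fin d) 𝕜}
    (hW : W.PosSemidef) (hM : M.PosSemidef) {b : ℝ} (hb : 0 ≤ b) (hMW : (b • W - M).PosSemidef) :
    ∃ (e : Fin d → EuclideanSpace 𝕜 (Fin d)) (l : Fin d → ℝ), (∀ i, 0 ≤ l i ∧ l i ≤ b) ∧
      (∀ i, toEuclideanLin M (e i) = (l i : 𝕜) • toEuclideanLin W (e i)) ∧
      ∀ u, ∃ c : Fin d → 𝕜, toEuclideanLin W u = ∑ i, c i • toEuclideanLin W (e i) := by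
  obtain ⟨R, P, hR, hP, hRR, hPR, hRPR, hPRP⟩ := exists_sqrt_pinv hW
  have hle : ∀ v, quadForm M v ≤ b * quadForm W v := fun v => by
    have := quadForm_nonneg hMW v
    rw [quadForm_sub, quadForm_smul] at this
    linarith
  have hWPR : W * (P * R) = W := by rw [← hRR, mul_assoc, ← mul_assoc R P R, hRPR]
  -- `ker W ⊆ ker M`, so `M` is not changed by the projection `P R` onto the range of `W`.
  have hMPR : M * (P * R) = M := by
    refine toEuclideanLin.injective (LinearMap.ext fun v => ?_)
    have hk : toEuclideanLin W (v - toEuclideanLin (P * R) v) = 0 := by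
      rw [map_sub, ← toEuclideanLin_mul_apply, hWPR, sub_self]
    have h0 : quadForm M (v - toEuclideanLin (P * R) v) = 0 := by
      refine le_antisymm ((hle _).trans_eq ?_) (quadForm_nonneg hM _)
      rw [quadForm, hk]; simp
    have h1 := toEuclideanLin_eq_zero_of_quadForm hM h0
    rw [map_sub, ← toEuclideanLin_mul_apply, sub_eq_zero] at h1
    exact h1.symm
  have hRPM : R * P * M = M := by
    have h := congrArg conjTranspose hMPR
    rwa [conjTranspose_mul, conjTranspose_mul, hM.1.eq, hP.eq, hR.eq] at h
  have hm : (P * M * P).IsHermitian := by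
    change (P * M * P)ᴴ = _
    rw [conjTranspose_mul, conjTranspose_mul, hM.1.eq, hP.eq, mul_assoc]
  set u := hm.eigenvectorBasis with hu
  have hev : ∀ i, toEuclideanLin (P * M * P) (u i) = (hm.eigenvalues i : 𝕜) • u i := by
    intro i
    refine (WithLp.ofLp_injective 2) ?_
    have := hm.mulVec_eigenvectorBasis i
    rw [RCLike.real_smul_eq_coe_smul (K := 𝕜)] at this
    rw [toLpLin_apply, this]
    rfl
  have hunit : ∀ i, inner 𝕜 (u i) (u i) = (1 : 𝕜) := fun i => by
    rw [inner_self_eq_norm_sq_to_K, u.orthonormal.1 i]; simp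
  have hlam : ∀ i, hm.eigenvalues i = quadForm M (toEuclideanLin P (u i)) := by
    intro i
    rw [← quadForm_mul_mul hP, quadForm, hev, inner_smul_right, hunit]; simp
  have hWP : ∀ v, toEuclideanLin W (toEuclideanLin P v) = toEuclideanLin R v := by
    intro v
    rw [← toEuclideanLin_mul_apply, ← hRR, mul_assoc, ← hPR, ← mul_assoc, hRPR]
  refine ⟨fun i => toEuclideanLin P (u i), hm.eigenvalues, fun i => ⟨?_, ?_⟩, fun i => ?_,
    fun v => ⟨fun i => inner 𝕜 (u i) (toEuclideanLin R v), ?_⟩⟩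
  · rw [hlam]; exact quadForm_nonneg hM _
  · by_cases h0 : hm.eigenvalues i = 0
    · rwa [h0]
    -- A nonzero eigenvalue has its eigenvector in the range of `P`, on which `P R` is the identity.
    have h1 : toEuclideanLin (P * R) (u i) = u i := by
      have h2 : (hm.eigenvalues i : 𝕜) • toEuclideanLin (P * R) (u i) =
          (hm.eigenvalues i : 𝕜) • u i := by
        rw [← map_smul, ← hev, ← toEuclideanLin_mul_apply]
        congr 2
        rw [← mul_assoc, ← mul_assoc, hPRP]
      exact smul_right_injective _ (RCLike.ofReal_ne_zero.2 h0) h2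
    have h3 : quadForm W (toEuclideanLin P (u i)) = 1 := by
      rw [quadForm, hWP, inner_toEuclideanLin_left hP, ← toEuclideanLin_mul_apply, h1, hunit]
      simp
    rw [hlam]
    simpa [h3] using hle (toEuclideanLin P (u i))
  · rw [hWP, ← map_smul, ← hev, ← toEuclideanLin_mul_apply, ← toEuclideanLin_mul_apply]
    congr 2
    rw [← mul_assoc, ← mul_assoc, hRPM]
  · simp only [hWP]
    conv_lhs => rw [← hRR, toEuclideanLin_mul_apply, ← u.sum_repr' (toEuclideanLin R v)]
    simp

/-! ### Interpolation of resolvents -/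

/-- The value at `0` of the Lagrange basis polynomial with nodes `1, …, d` that belongs to the node
`k + 1`. -/
noncomputable def lagrangeAtZero (d : ℕ) (k : ℕ) : ℝ :=
  (Lagrange.basis (Finset.range d) (fun j : ℕ => (j : ℝ) + 1) k).eval 0

/-- Interpolation of a polynomial of degree less than `d` from the nodes `1, …, d`. -/
theorem sum_lagrangeAtZero_mul_eval {d : ℕ} {p : Polynomial ℝ} (hp : p.degree < d) :
    ∑ k ∈ Finset.range d, lagrangeAtZero d k * p.eval ((k : ℝ) + 1) = p.eval 0 := by
  have hinj : Set.InjOn (fun j : ℕ => (j : ℝ) + 1) (Finset.range d : Set ℕ) := by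
    intro i _ j _ h
    simpa using h
  conv_rhs => rw [Lagrange.eq_interpolate (f := p) hinj (by simpa using hp), Lagrange.interpolate_apply]
  simp [Polynomial.eval_finsetSum, lagrangeAtZero, mul_comm]

/-- The weights of `exists_resolvent_interpolation` are at most this number. -/
noncomputable def interpolationBound (d : ℕ) : ℝ :=
  ∑ k ∈ Finset.range d, |lagrangeAtZero d k| * ((d : ℝ) + 1) ^ d

theorem interpolationBound_nonneg (d : ℕ) : 0 ≤ interpolationBound d :=
  Finset.sum_nonneg fun _ _ => by positivity

/-- A vector `f` of the range of `W` is a combination with bounded weights of the vectors `W v`,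
where `v` solves `(W + s M) v = f` with `s = 1 / b, …, d / b`. Indeed
`det (W + s M) • W v`, suitably normalized, is a polynomial in `s` of degree less than `d` with the
value `f` at `s = 0`. -/
theorem exists_resolvent_interpolation {W M : Matrix (Fin d) (Fin d) 𝕜}
    (hW : W.PosSemidef) (hM : M.PosSemidef) {b : ℝ} (hb : 0 < b) (hMW : (b • W - M).PosSemidef)
    {f : EuclideanSpace 𝕜 (Fin d)} (hf : ∃ u, toEuclideanLin W u = f) :
    ∃ (v : ℕ → EuclideanSpace 𝕜 (Fin d)) (c : ℕ → ℝ),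
      (∀ k : ℕ, toEuclideanLin (W + (((k : ℝ) + 1) / b) • M) (v k) = f) ∧
      (∀ k ∈ Finset.range d, |c k| ≤ interpolationBound d) ∧
      f = ∑ k ∈ Finset.range d, ((c k : ℝ) : 𝕜) • toEuclideanLin W (v k) := by
  obtain ⟨u, rfl⟩ := hf
  obtain ⟨e, l, hl, hMe, hspan⟩ := exists_simultaneous_diagonalization hW hM hb.le hMW
  obtain ⟨c, hc⟩ := hspan u
  set t : Fin d → ℝ := fun i => l i / b with ht
  have ht0 : ∀ i, 0 ≤ t i := fun i => div_nonneg (hl i).1 hb.le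
  have ht1 : ∀ i, t i ≤ 1 := fun i => (div_le_one hb).2 (hl i).2
  have hpos : ∀ (k : ℕ) i, 0 < 1 + ((k : ℝ) + 1) * t i := fun k i => by
    have := ht0 i; positivity
  have hne : ∀ (k : ℕ) i, (1 + ((k : ℝ) + 1) * t i) ≠ 0 := fun k i => (hpos k i).ne'
  refine ⟨fun k => ∑ i, (((1 + ((k : ℝ) + 1) * t i)⁻¹ : ℝ) : 𝕜) • c i • e i,
    fun k => lagrangeAtZero d k * ∏ i, (1 + ((k : ℝ) + 1) * t i), fun k => ?_, fun k hk => ?_, ?_⟩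
  · rw [hc, map_sum]
    refine Finset.sum_congr rfl fun i _ => ?_
    have h1 : toEuclideanLin (W + (((k : ℝ) + 1) / b) • M) (e i) =
        ((1 + ((k : ℝ) + 1) * t i : ℝ) : 𝕜) • toEuclideanLin W (e i) := by
      rw [map_add, LinearMap.add_apply, toEuclideanLin_real_smul, hMe, smul_smul,
        ← RCLike.ofReal_mul, RCLike.ofReal_add, add_smul, RCLike.ofReal_one, one_smul]
      congr 3
      simp only [ht]; ring
    rw [map_smul, map_smul, h1, smul_comm (c i), smul_smul, ← RCLike.ofReal_mul,
      inv_mul_cancel₀ (hne k i), RCLike.ofReal_one, one_smul]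
  · have hk' : (k : ℝ) + 1 ≤ d := by exact_mod_cast Finset.mem_range.1 hk
    have h1 : ∏ i, (1 + ((k : ℝ) + 1) * t i) ≤ ((d : ℝ) + 1) ^ d := by
      calc ∏ i, (1 + ((k : ℝ) + 1) * t i) ≤ ∏ _i : Fin d, ((d : ℝ) + 1) := by
            refine Finset.prod_le_prod (fun i _ => (hpos k i).le) fun i _ => ?_
            have h3 : ((k : ℝ) + 1) * t i ≤ (k + 1) * 1 :=
              mul_le_mul_of_nonneg_left (ht1 i) (by positivity)
            linarith
        _ = _ := by simp
    have h0 : 0 ≤ ∏ i, (1 + ((k : ℝ) + 1) * t i) := Finset.prod_nonneg fun i _ => (hpos k i).le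
    rw [abs_mul, abs_of_nonneg h0]
    calc |lagrangeAtZero d k| * ∏ i, (1 + ((k : ℝ) + 1) * t i)
        ≤ |lagrangeAtZero d k| * ((d : ℝ) + 1) ^ d :=
          mul_le_mul_of_nonneg_left h1 (abs_nonneg _)
      _ ≤ _ := Finset.single_le_sum (f := fun k => |lagrangeAtZero d k| * ((d : ℝ) + 1) ^ d)
          (fun k _ => by positivity) hk
  · let p : Fin d → Polynomial ℝ := fun i =>
      ∏ j ∈ Finset.univ.erase i, (1 + Polynomial.C (t j) * Polynomial.X)
    have hdeg : ∀ i, (p i).degree < d := by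
      intro i
      have h1 : (p i).natDegree ≤ d - 1 := by
        refine (Polynomial.natDegree_prod_le _ _).trans ?_
        calc ∑ j ∈ Finset.univ.erase i, (1 + Polynomial.C (t j) * Polynomial.X).natDegree
            ≤ ∑ _j ∈ Finset.univ.erase i, 1 := by
              refine Finset.sum_le_sum fun j _ => ?_
              compute_degree
          _ = d - 1 := by simp
      have h2 := i.pos
      refine (Polynomial.degree_le_natDegree).trans_lt ?_
      exact_mod_cast (show (p i).natDegree < d by omega)
    have heval : ∀ i x, (p i).eval x = ∏ j ∈ Finset.univ.erase i, (1 + t j * x) := by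
      intro i x; simp [p, Polynomial.eval_prod]
    have h0 : ∀ i, ∑ k ∈ Finset.range d, lagrangeAtZero d k *
        ((∏ j, (1 + ((k : ℝ) + 1) * t j)) * (1 + ((k : ℝ) + 1) * t i)⁻¹) = 1 := by
      intro i
      have h1 := sum_lagrangeAtZero_mul_eval (hdeg i)
      rw [heval i 0] at h1
      simp only [mul_zero, add_zero, Finset.prod_const_one] at h1
      refine Eq.trans (Finset.sum_congr rfl fun k _ => ?_) h1
      rw [heval, ← Finset.mul_prod_erase _ _ (Finset.mem_univ i), mul_comm (1 + _), mul_assoc,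
        mul_inv_cancel₀ (hne k i), mul_one]
      simp only [mul_comm]
    simp only [map_sum, map_smul, Finset.smul_sum]
    rw [Finset.sum_comm]
    conv_lhs => rw [hc]
    refine Finset.sum_congr rfl fun i _ => ?_
    simp only [smul_smul _ _ (c i • _), ← RCLike.ofReal_mul]
    rw [← Finset.sum_smul, ← RCLike.ofReal_sum]
    simp only [mul_assoc, h0 i]
    simp

end LinearAlgebra

/-! ### The tree of atoms -/

namespace AtomicFiltration

variable {X : Type*} [MeasurableSpace X] {𝓕 : AtomicFiltration X}

theorem Atom.ext' {I J : 𝓕.Atom} (hr : I.rk = J.rk) (h : I.carrier = J.carrier) : I = J := by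
  cases I; cases J; subst hr; subst h; rfl

theorem Atom.measurableSet (I : 𝓕.Atom) : MeasurableSet I.carrier :=
  𝓕.measurableSet_of_mem_atoms I.mem

theorem Atom.mem_ring (I : 𝓕.Atom) : I.carrier ∈ 𝓕.ring := AtomicFiltration.mem_ring 𝓕 I.mem

theorem Atom.sub_refl (I : 𝓕.Atom) : I.Sub I := ⟨subset_rfl, le_rfl⟩

theorem Atom.Sub.trans {I J K : 𝓕.Atom} (h : I.Sub J) (h' : J.Sub K) : I.Sub K :=
  ⟨h.1.trans h'.1, h'.2.trans h.2⟩

/-- Atoms of one generation with a common point are equal. -/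
theorem Atom.eq_of_mem {I J : 𝓕.Atom} (hr : I.rk = J.rk) {x : X} (hI : x ∈ I.carrier)
    (hJ : x ∈ J.carrier) : I = J := by
  refine Atom.ext' hr (by_contra fun h => ?_)
  exact Set.disjoint_left.1 (𝓕.disjoint_atoms J.rk (hr ▸ I.mem) J.mem h) hI hJ

instance countable_atom : Countable 𝓕.Atom := by
  have : ∀ n, Countable (𝓕.atoms n) := fun n => (𝓕.countable_atoms n).to_subtype
  refine Function.Injective.countable (β := Σ n, 𝓕.atoms n)
    (f := fun I => ⟨I.rk, I.carrier, I.mem⟩) fun I J h => ?_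
  cases I; cases J
  simp only [Sigma.mk.injEq] at h
  obtain ⟨rfl, h⟩ := h
  simpa using h

/-- The children of an atom: the nonempty atoms of the next generation inside it. The empty set,
which may be an atom of every generation, is left out so that a child determines its parent. -/
def children (I : 𝓕.Atom) : Set 𝓕.Atom :=
  {J | J.rk = I.rk + 1 ∧ J.carrier ⊆ I.carrier ∧ J.carrier.Nonempty}

theorem sub_of_mem_children {I J : 𝓕.Atom} (h : J ∈ children I) : J.Sub I :=
  ⟨h.2.1, by have := h.1; omega⟩

theorem disjoint_children (I : 𝓕.Atom) :
    Pairwise (Function.onFun Disjoint fun J : children I => J.1.carrier) := by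
  refine fun J K h => Set.disjoint_left.2 fun x hJ hK => h (Subtype.ext ?_)
  exact Atom.eq_of_mem (J.2.1.trans K.2.1.symm) hJ hK

theorem iUnion_children (I : 𝓕.Atom) : ⋃ J : children I, J.1.carrier = I.carrier := by
  refine subset_antisymm (Set.iUnion_subset fun J => J.2.2.1) fun x hx => ?_
  have hI : MeasurableSet[𝓕.F (I.rk + 1)] I.carrier :=
    𝓕.F.mono (by omega : I.rk ≤ I.rk + 1) _ (𝓕.measurableSet_atoms _ _ I.mem)
  obtain ⟨S, hS, hIS⟩ := 𝓕.eq_sUnion_atoms _ _ hI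
  obtain ⟨J, hJ, hxJ⟩ : ∃ J ∈ S, x ∈ J := by rwa [hIS] at hx
  exact Set.mem_iUnion.2 ⟨⟨⟨J, I.rk + 1, hS hJ⟩, rfl,
    by rw [hIS]; exact Set.subset_sUnion_of_mem hJ, ⟨x, hxJ⟩⟩, hxJ⟩

theorem disjoint_generation (n : ℤ) :
    Pairwise (Function.onFun Disjoint fun I : {I : 𝓕.Atom // I.rk = n} => I.1.carrier) := by
  refine fun J K h => Set.disjoint_left.2 fun x hJ hK => h (Subtype.ext ?_)
  exact Atom.eq_of_mem (J.2.trans K.2.symm) hJ hK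

theorem iUnion_generation (n : ℤ) :
    ⋃ I : {I : 𝓕.Atom // I.rk = n}, I.1.carrier = Set.univ := by
  refine Set.eq_univ_of_forall fun x => ?_
  obtain ⟨I, hI, hx⟩ : ∃ I ∈ 𝓕.atoms n, x ∈ I := by
    have : x ∈ ⋃₀ 𝓕.atoms n := by rw [𝓕.sUnion_atoms]; trivial
    exact this
  exact Set.mem_iUnion.2 ⟨⟨⟨I, n, hI⟩, rfl⟩, hx⟩

/-- The families of the subatoms of the children of `I` are disjoint up to empty atoms, and none
of them contains `I`. -/
theorem add_tsum_children_le {g : 𝓕.Atom → ℝ≥0∞} (hg : ∀ K, K.carrier = ∅ → g K = 0)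
    (I : 𝓕.Atom) :
    g I + ∑' J : children I, ∑' K : {K : 𝓕.Atom // K.Sub J.1}, g K ≤
      ∑' K : {K : 𝓕.Atom // K.Sub I}, g K := by
  classical
  have hne : ∀ J : 𝓕.Atom, ∑' K : {K : 𝓕.Atom // K.Sub J}, g K =
      ∑' K : {K : 𝓕.Atom // K.Sub J ∧ K.carrier.Nonempty}, g K := by
    intro J
    refine (tsum_subtype {K : 𝓕.Atom | K.Sub J} g).trans (Eq.trans ?_
      (tsum_subtype {K : 𝓕.Atom | K.Sub J ∧ K.carrier.Nonempty} g).symm)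
    refine tsum_congr fun K => ?_
    by_cases hK : K.carrier = ∅
    · simp [Set.indicator_apply, hg K hK]
    · simp [Set.indicator_apply, Set.nonempty_iff_ne_empty, hK]
  simp only [hne]
  rw [← hne I, ENNReal.tsum_eq_add_tsum_ite (⟨I, I.sub_refl⟩ : {K : 𝓕.Atom // K.Sub I}),
    ← ENNReal.tsum_sigma' (f := fun p : Σ J : children I,
      {K : 𝓕.Atom // K.Sub J.1 ∧ K.carrier.Nonempty} => g p.2.1)]
  refine add_le_add le_rfl ?_
  let φ : (Σ J : children I, {K : 𝓕.Atom // K.Sub J.1 ∧ K.carrier.Nonempty}) →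
      {K : 𝓕.Atom // K.Sub I} :=
    fun p => ⟨p.2.1, p.2.2.1.trans (sub_of_mem_children p.1.2)⟩
  have hφ : Function.Injective φ := by
    rintro ⟨J, K, hK, hKn⟩ ⟨J', K', hK', hKn'⟩ h
    obtain rfl : K = K' := congrArg Subtype.val h
    obtain ⟨x, hx⟩ := hKn
    obtain rfl : J = J' :=
      Subtype.ext (Atom.eq_of_mem (J.2.1.trans J'.2.1.symm) (hK.1 hx) (hK'.1 hx))
    rfl
  refine le_trans (ENNReal.tsum_le_tsum fun p => ?_)
    (ENNReal.tsum_comp_le_tsum_of_injective hφ _)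
  have hpI : φ p ≠ ⟨I, I.sub_refl⟩ := by
    intro h
    have h1 : p.2.1 = I := congrArg Subtype.val h
    have h2 := p.2.2.1.2
    have h3 := p.1.2.1
    rw [h1] at h2
    omega
  rw [if_neg hpI]

/-- Telescoping over the generations: if `t` is dominated by the increments of `q`, and the sums of
`q` over the generations are at most `c`, then the sum of `t` over all atoms is at most `c`. -/
theorem tsum_le_of_add_le_tsum_children {q t : 𝓕.Atom → ℝ≥0∞} {c : ℝ≥0∞}
    (hstep : ∀ I, q I + t I ≤ ∑' J : children I, q J)
    (hq : ∀ n : ℤ, ∑' I : {I : 𝓕.Atom // I.rk = n}, q I ≤ c) :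
    ∑' I, t I ≤ c := by
  have h1 : ∀ n : ℤ, (∑' I : {I : 𝓕.Atom // I.rk = n}, q I) +
      ∑' I : {I : 𝓕.Atom // I.rk = n}, t I ≤ ∑' I : {I : 𝓕.Atom // I.rk = n + 1}, q I := by
    intro n
    rw [← ENNReal.tsum_add]
    refine (ENNReal.tsum_le_tsum fun I : {I : 𝓕.Atom // I.rk = n} => hstep I.1).trans ?_
    rw [← ENNReal.tsum_sigma' (f := fun p : Σ I : {I : 𝓕.Atom // I.rk = n}, children I.1 =>
      q p.2.1)]
    let φ : (Σ I : {I : 𝓕.Atom // I.rk = n}, children I.1) → {I : 𝓕.Atom // I.rk = n + 1} :=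
      fun p => ⟨p.2.1, by rw [p.2.2.1, p.1.2]⟩
    have hφ : Function.Injective φ := by
      rintro ⟨I, J, hJ⟩ ⟨I', J', hJ'⟩ h
      obtain rfl : J = J' := congrArg Subtype.val h
      obtain ⟨x, hx⟩ := hJ.2.2
      obtain rfl : I = I' :=
        Subtype.ext (Atom.eq_of_mem (I.2.trans I'.2.symm) (hJ.2.1 hx) (hJ'.2.1 hx))
      rfl
    exact ENNReal.tsum_comp_le_tsum_of_injective hφ fun I : {I : 𝓕.Atom // I.rk = n + 1} => q I.1
  have h2 : ∀ (m : ℤ) (N : ℕ), ∑ k ∈ Finset.range N, ∑' I : {I : 𝓕.Atom // I.rk = m + k}, t I ≤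
      ∑' I : {I : 𝓕.Atom // I.rk = m + N}, q I := by
    intro m N
    induction N with
    | zero => simp
    | succ N ih =>
      rw [Finset.sum_range_succ]
      refine (add_le_add ih le_rfl).trans ((h1 (m + N)).trans_eq ?_)
      rw [show m + ((N + 1 : ℕ) : ℤ) = m + N + 1 by push_cast; ring]
  rw [← (Equiv.sigmaFiberEquiv (Atom.rk (𝓕 := 𝓕))).tsum_eq t, ENNReal.tsum_sigma',
    ENNReal.tsum_eq_iSup_sum]
  refine iSup_le fun s => ?_
  obtain ⟨m, N, hs⟩ : ∃ (m : ℤ) (N : ℕ), s ⊆ (Finset.range N).image fun k : ℕ => m + k := by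
    obtain ⟨m, hm⟩ := s.bddBelow
    obtain ⟨M, hM⟩ := s.bddAbove
    refine ⟨m, (M + 1 - m).toNat, fun n hn => ?_⟩
    have h3 := hm hn
    have h4 := hM hn
    refine Finset.mem_image.2 ⟨(n - m).toNat, Finset.mem_range.2 ?_, ?_⟩ <;> omega
  refine (Finset.sum_le_sum_of_subset hs).trans ?_
  rw [Finset.sum_image fun a _ b _ h => by simpa using h]
  exact (h2 m N).trans (hq _)

end AtomicFiltration

/-! ### Integrals with respect to a matrix measure -/

namespace MatrixMeasure

open MeasureTheory Matrix AtomicFiltration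

variable {X : Type*} [MeasurableSpace X] {𝓕 : AtomicFiltration X} {𝕜 : Type*} [RCLike 𝕜] {d : ℕ}
variable (W : MatrixMeasure 𝓕 𝕜 d)

/-- The part `∫_E ⟨W(dx) f(x), f(x)⟩` of `‖f‖²_{L²(W)}`. -/
noncomputable def normSqOn (E : Set X) (f : X → EuclideanSpace 𝕜 (Fin d)) : ℝ≥0∞ :=
  ∫⁻ x in E, ENNReal.ofReal (quadForm (W.density x) (f x)) ∂W.traceMeasure

theorem normSqOn_univ (f : X → EuclideanSpace 𝕜 (Fin d)) : W.normSqOn Set.univ f = W.normSq f := by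
  rw [normSqOn, Measure.restrict_univ]; rfl

theorem normSqOn_lt_top {f : X → EuclideanSpace 𝕜 (Fin d)} (hf : W.MemL2 f) (E : Set X) :
    W.normSqOn E f < ⊤ :=
  (setLIntegral_le_lintegral E _).trans_lt hf.2

theorem toEuclideanLin_eq_sum (M : Matrix (Fin d) (Fin d) 𝕜) (v : EuclideanSpace 𝕜 (Fin d)) :
    toEuclideanLin M v = ∑ j, ∑ k, M j k • (v k • EuclideanSpace.single j (1 : 𝕜)) := by
  ext i
  rw [Finset.sum_comm]
  simp [toLpLin_apply, mulVec, dotProduct, Pi.single_apply]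

theorem integrableOn_toEuclideanLin_const {E : Set X} (hE : E ∈ 𝓕.ring)
    (v : EuclideanSpace 𝕜 (Fin d)) :
    IntegrableOn (fun x => toEuclideanLin (W.density x) v) E W.traceMeasure := by
  simp only [toEuclideanLin_eq_sum]
  exact integrable_finsetSum _ fun j _ => integrable_finsetSum _ fun k _ =>
    (W.isDensity_density.integrableOn E hE j k).smul_const _

theorem integral_const {E : Set X} (hE : E ∈ 𝓕.ring) (v : EuclideanSpace 𝕜 (Fin d)) :
    W.integral E (fun _ => v) = toEuclideanLin (W E) v := by
  have hi : ∀ j k, Integrable (fun x => W.density x j k • (v k • EuclideanSpace.single j (1 : 𝕜)))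
      (W.traceMeasure.restrict E) :=
    fun j k => (W.isDensity_density.integrableOn E hE j k).smul_const _
  simp only [integral, toEuclideanLin_eq_sum]
  rw [integral_finsetSum _ fun j _ => integrable_finsetSum _ fun k _ => hi j k]
  refine Finset.sum_congr rfl fun j _ => ?_
  rw [integral_finsetSum _ fun k _ => hi j k]
  refine Finset.sum_congr rfl fun k _ => ?_
  rw [_root_.integral_smul_const, W.isDensity_density.integral_eq E hE]

theorem integrableOn_quadForm_const {E : Set X} (hE : E ∈ 𝓕.ring)
    (v : EuclideanSpace 𝕜 (Fin d)) :
    IntegrableOn (fun x => quadForm (W.density x) v) E W.traceMeasure :=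
  ((W.integrableOn_toEuclideanLin_const hE v).const_inner (𝕜 := 𝕜) v).re

theorem integral_quadForm_const {E : Set X} (hE : E ∈ 𝓕.ring) (v : EuclideanSpace 𝕜 (Fin d)) :
    ∫ x in E, quadForm (W.density x) v ∂W.traceMeasure = quadForm (W E) v := by
  have hi := W.integrableOn_toEuclideanLin_const hE v
  simp only [quadForm]
  rw [integral_re (hi.const_inner v), integral_inner hi v, ← W.integral_const hE v]
  rfl

theorem normSq_indicator {E : Set X} (hE : E ∈ 𝓕.ring) (v : EuclideanSpace 𝕜 (Fin d)) :
    W.normSq (E.indicator fun _ => v) = ENNReal.ofReal (quadForm (W E) v) := by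
  have hEm := 𝓕.measurableSet_of_mem_ring hE
  have h : (fun x => ENNReal.ofReal (RCLike.re (inner 𝕜 (E.indicator (fun _ => v) x)
      (toEuclideanLin (W.density x) (E.indicator (fun _ => v) x))))) =
      E.indicator fun x => ENNReal.ofReal (quadForm (W.density x) v) := by
    funext x
    by_cases hx : x ∈ E <;> simp [hx, quadForm]
  rw [normSq, h, lintegral_indicator hEm, ← W.integral_quadForm_const hE,
    ofReal_integral_eq_lintegral_ofReal (W.integrableOn_quadForm_const hE v)]
  exact Filter.Eventually.of_forall fun x =>
    quadForm_nonneg (W.isDensity_density.posSemidef x) v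

theorem memL2_indicator {E : Set X} (hE : E ∈ 𝓕.ring) (v : EuclideanSpace 𝕜 (Fin d)) :
    W.MemL2 (E.indicator fun _ => v) :=
  ⟨measurable_const.indicator (𝓕.measurableSet_of_mem_ring hE), by
    rw [W.normSq_indicator hE]; exact ENNReal.ofReal_lt_top⟩

theorem integral_indicator_of_subset {E G : Set X} (hE : E ∈ 𝓕.ring) (hEG : E ⊆ G)
    (v : EuclideanSpace 𝕜 (Fin d)) :
    W.integral E (G.indicator fun _ => v) = toEuclideanLin (W E) v := by
  rw [← W.integral_const hE]
  refine setIntegral_congr_fun (𝓕.measurableSet_of_mem_ring hE) fun x hx => ?_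
  simp [hEG hx]

theorem integrable_quadForm {f : X → EuclideanSpace 𝕜 (Fin d)} (hf : W.MemL2 f) :
    Integrable (fun x => quadForm (W.density x) (f x)) W.traceMeasure := by
  have hfj : ∀ j, Measurable fun x => f x j := fun j => by
    have := hf.1
    fun_prop
  refine ⟨Measurable.aestronglyMeasurable ?_, ?_⟩
  · simp only [quadForm, inner_toEuclideanLin_eq, dotProduct, mulVec, Pi.star_apply]
    refine RCLike.measurable_re.comp (Finset.measurable_sum _ fun j _ =>
      Measurable.mul ?_ (Finset.measurable_sum _ fun k _ =>
        (W.isDensity_density.measurable j k).mul (hfj k)))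
    exact RCLike.continuous_conj.measurable.comp (hfj j)
  · rw [hasFiniteIntegral_iff_ofReal (Filter.Eventually.of_forall fun x =>
      quadForm_nonneg (W.isDensity_density.posSemidef x) (f x))]
    exact hf.2

theorem toReal_normSqOn {f : X → EuclideanSpace 𝕜 (Fin d)} (hf : W.MemL2 f) (E : Set X) :
    (W.normSqOn E f).toReal = ∫ x in E, quadForm (W.density x) (f x) ∂W.traceMeasure := by
  rw [normSqOn, ← ofReal_integral_eq_lintegral_ofReal (W.integrable_quadForm hf).integrableOn,
    ENNReal.toReal_ofReal]
  · exact integral_nonneg fun x => quadForm_nonneg (W.isDensity_density.posSemidef x) (f x)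
  · exact Filter.Eventually.of_forall fun x =>
      quadForm_nonneg (W.isDensity_density.posSemidef x) (f x)

/-- Integrated form of `⟨w (f - u), f - u⟩ ≥ 0`. -/
theorem two_mul_re_inner_integral_sub_le {f : X → EuclideanSpace 𝕜 (Fin d)} (hf : W.MemL2 f)
    {E : Set X} (hE : E ∈ 𝓕.ring) (u : EuclideanSpace 𝕜 (Fin d)) :
    2 * RCLike.re (inner 𝕜 (W.integral E f) u) - quadForm (W E) u ≤
      (W.normSqOn E f).toReal := by
  have hi := W.integrableOn_of_memL2 hf hE
  have h1 : RCLike.re (inner 𝕜 (W.integral E f) u) =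
      ∫ x in E, RCLike.re (inner 𝕜 u (toEuclideanLin (W.density x) (f x))) ∂W.traceMeasure := by
    rw [integral_re (hi.const_inner u), integral_inner hi u]
    exact inner_re_symm _ _
  have hi1 : IntegrableOn (fun x => RCLike.re (inner 𝕜 u (toEuclideanLin (W.density x) (f x))))
      E W.traceMeasure := (hi.const_inner (𝕜 := 𝕜) u).re
  have hi2 := W.integrableOn_quadForm_const hE u
  rw [W.toReal_normSqOn hf, h1, ← W.integral_quadForm_const hE, ← integral_const_mul,
    ← integral_sub (hi1.const_mul 2) hi2]
  refine integral_mono ((hi1.const_mul 2).sub hi2) (W.integrable_quadForm hf).integrableOn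
    fun x => ?_
  have h := quadForm_nonneg (W.isDensity_density.posSemidef x) (f x - u)
  rw [quadForm_sub_vec (W.isDensity_density.posSemidef x).1,
    inner_re_symm (𝕜 := 𝕜) (toEuclideanLin _ (f x)) u] at h
  change 2 * RCLike.re (inner 𝕜 u (toEuclideanLin (W.density x) (f x))) -
    quadForm (W.density x) u ≤ quadForm (W.density x) (f x)
  linarith

/-- `∫_E W(dx) f(x)` is orthogonal to the kernel of `W(E)`, hence in the range of `W(E)`. -/
theorem exists_toEuclideanLin_eq_integral {f : X → EuclideanSpace 𝕜 (Fin d)} (hf : W.MemL2 f)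
    {E : Set X} (hE : E ∈ 𝓕.ring) : ∃ u, toEuclideanLin (W E) u = W.integral E f := by
  have hsym := isSymmetric_toEuclideanLin_iff.2 (W.posSemidef E hE).1
  suffices h : W.integral E f ∈ (LinearMap.range (toEuclideanLin (W E)))ᗮᗮ by
    rwa [Submodule.orthogonal_orthogonal] at h
  rw [hsym.orthogonal_range, Submodule.mem_orthogonal']
  intro u hu
  rw [LinearMap.mem_ker] at hu
  set a := inner 𝕜 (W.integral E f) u with ha
  have h1 : ∀ r : ℝ, 2 * (r * ‖a‖ ^ 2) ≤ (W.normSqOn E f).toReal := by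
    intro r
    have h := W.two_mul_re_inner_integral_sub_le hf hE (((r : 𝕜) * star a) • u)
    have hq : quadForm (W E) (((r : 𝕜) * star a) • u) = 0 := by
      rw [quadForm, map_smul, hu]; simp
    rw [hq, inner_smul_right, ← ha, mul_assoc, RCLike.re_ofReal_mul, RCLike.star_def,
      RCLike.conj_mul, sub_zero] at h
    exact_mod_cast h
  by_contra hne
  have hpos : 0 < ‖a‖ ^ 2 := by positivity
  have h2 := h1 (((W.normSqOn E f).toReal + 1) / ‖a‖ ^ 2)
  rw [div_mul_cancel₀ _ hpos.ne'] at h2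
  have h3 : 0 ≤ (W.normSqOn E f).toReal := ENNReal.toReal_nonneg
  linarith

theorem hasSum_integral_children {f : X → EuclideanSpace 𝕜 (Fin d)} (hf : W.MemL2 f)
    (I : 𝓕.Atom) :
    HasSum (fun J : children I => W.integral J.1.carrier f) (W.integral I.carrier f) := by
  have h := hasSum_integral_iUnion (μ := W.traceMeasure)
    (f := fun x => toEuclideanLin (W.density x) (f x)) (fun J : children I => J.1.measurableSet)
    (disjoint_children I)
    (by rw [iUnion_children]; exact W.integrableOn_of_memL2 hf I.mem_ring)
  rwa [iUnion_children] at h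

theorem hasSum_apply_children (I : 𝓕.Atom) :
    HasSum (fun J : children I => W J.1.carrier) (W I.carrier) := by
  have h := W.hasSum_inter I.mem_ring (fun J : children I => J.1.measurableSet)
    (disjoint_children I)
  rw [iUnion_children, Set.inter_self] at h
  have h' : ∀ J : children I, J.1.carrier ∩ I.carrier = J.1.carrier := fun J =>
    Set.inter_eq_left.2 J.2.2.1
  simpa only [h'] using h

theorem tsum_normSqOn_children (f : X → EuclideanSpace 𝕜 (Fin d)) (I : 𝓕.Atom) :
    ∑' J : children I, W.normSqOn J.1.carrier f = W.normSqOn I.carrier f := by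
  have h := lintegral_iUnion (μ := W.traceMeasure) (fun J : children I => J.1.measurableSet)
    (disjoint_children I) fun x => ENNReal.ofReal (quadForm (W.density x) (f x))
  rw [iUnion_children] at h
  exact h.symm

theorem tsum_normSqOn_generation (f : X → EuclideanSpace 𝕜 (Fin d)) (n : ℤ) :
    ∑' I : {I : 𝓕.Atom // I.rk = n}, W.normSqOn I.1.carrier f = W.normSq f := by
  have h := lintegral_iUnion (μ := W.traceMeasure)
    (fun I : {I : 𝓕.Atom // I.rk = n} => I.1.measurableSet)
    (disjoint_generation n) fun x => ENNReal.ofReal (quadForm (W.density x) (f x))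
  rw [iUnion_generation] at h
  rw [← normSqOn_univ]
  exact h.symm


/-! ### The Bellman function argument -/

theorem summable_of_tsum_ofReal_ne_top {ι : Type*} {a : ι → ℝ} (ha : ∀ i, 0 ≤ a i)
    (h : ∑' i, ENNReal.ofReal (a i) ≠ ⊤) : Summable a := by
  have h1 := ENNReal.summable_toReal h
  simpa only [ENNReal.toReal_ofReal (ha _)] using h1

/-- The matrix `∑_{K ⊂ I} W(K) A_K W(K)` of the testing condition. -/
noncomputable def testingSum (A : 𝓕.Atom → Matrix (Fin d) (Fin d) 𝕜) (I : 𝓕.Atom) :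
    Matrix (Fin d) (Fin d) 𝕜 :=
  ∑' K : {K : 𝓕.Atom // K.Sub I}, W K.1.carrier * A K.1 * W K.1.carrier

theorem posSemidef_apply (I : 𝓕.Atom) : (W I.carrier).PosSemidef := W.posSemidef _ I.mem_ring

variable {A : 𝓕.Atom → Matrix (Fin d) (Fin d) 𝕜}

section Testing

variable {W} {b : ℝ≥0}

theorem Testing.hasSum_quadForm (hT : W.Testing A b) (I : 𝓕.Atom)
    (v : EuclideanSpace 𝕜 (Fin d)) :
    HasSum (fun K : {K : 𝓕.Atom // K.Sub I} =>
      quadForm (A K.1) (toEuclideanLin (W K.1.carrier) v)) (quadForm (W.testingSum A I) v) := by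
  have h := _root_.hasSum_quadForm (hT I).1.hasSum v
  simp only [quadForm_mul_mul (W.posSemidef_apply _).1] at h
  exact h

theorem isHermitian_testingSum (hA : ∀ I, (A I).PosSemidef) (I : 𝓕.Atom) :
    (W.testingSum A I).IsHermitian := by
  change (W.testingSum A I)ᴴ = _
  rw [testingSum, conjTranspose_tsum]
  refine tsum_congr fun K => ?_
  rw [conjTranspose_mul, conjTranspose_mul, (hA K.1).1.eq, (W.posSemidef_apply K.1).1.eq, mul_assoc]

theorem Testing.posSemidef_testingSum (hT : W.Testing A b) (hA : ∀ I, (A I).PosSemidef)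
    (I : 𝓕.Atom) : (W.testingSum A I).PosSemidef := by
  refine posSemidef_of_quadForm_nonneg (isHermitian_testingSum hA I) fun v => ?_
  have h0 : ∀ K : {K : 𝓕.Atom // K.Sub I},
      0 ≤ quadForm (A K.1) (toEuclideanLin (W K.1.carrier) v) := fun K => quadForm_nonneg (hA K.1) _
  exact (hT.hasSum_quadForm I v).nonneg h0

theorem Testing.ofReal_quadForm_testingSum (hT : W.Testing A b) (hA : ∀ I, (A I).PosSemidef)
    (I : 𝓕.Atom) (v : EuclideanSpace 𝕜 (Fin d)) :
    ENNReal.ofReal (quadForm (W.testingSum A I) v) = ∑' K : {K : 𝓕.Atom // K.Sub I},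
      ENNReal.ofReal (quadForm (A K.1) (toEuclideanLin (W K.1.carrier) v)) := by
  have h := hT.hasSum_quadForm I v
  have h0 : ∀ K : {K : 𝓕.Atom // K.Sub I},
      0 ≤ quadForm (A K.1) (toEuclideanLin (W K.1.carrier) v) := fun K => quadForm_nonneg (hA K.1) _
  rw [← h.tsum_eq, ENNReal.ofReal_tsum_of_nonneg h0 h.summable]

theorem Testing.summable_and_le (hT : W.Testing A b) (hA : ∀ I, (A I).PosSemidef)
    (I : 𝓕.Atom) (v : EuclideanSpace 𝕜 (Fin d)) :
    Summable (fun J : children I => quadForm (W.testingSum A J.1) v) ∧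
      quadForm (A I) (toEuclideanLin (W I.carrier) v) +
        ∑' J : children I, quadForm (W.testingSum A J.1) v ≤ quadForm (W.testingSum A I) v := by
  have h := add_tsum_children_le
    (g := fun K : 𝓕.Atom => ENNReal.ofReal (quadForm (A K) (toEuclideanLin (W K.carrier) v)))
    (fun K hK => by simp [hK, W.apply_empty, quadForm]) I
  simp only [← hT.ofReal_quadForm_testingSum hA] at h
  have h0 : ∀ J : children I, 0 ≤ quadForm (W.testingSum A J.1) v := fun J =>
    quadForm_nonneg (hT.posSemidef_testingSum hA J.1) v
  have hs := summable_of_tsum_ofReal_ne_top h0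
    (ne_top_of_le_ne_top ENNReal.ofReal_ne_top (le_add_self.trans h))
  refine ⟨hs, ?_⟩
  rw [← ENNReal.ofReal_tsum_of_nonneg h0 hs,
    ← ENNReal.ofReal_add (quadForm_nonneg (hA I) _) (tsum_nonneg h0)] at h
  exact (ENNReal.ofReal_le_ofReal_iff (quadForm_nonneg (hT.posSemidef_testingSum hA I) v)).1 h

/-- The main inequality and the upper bound for the Bellman function
`⟨(W(I) + s M(I))⁻¹ f_I, f_I⟩`, where `M(I)` is the sum of the testing condition and
`f_I = ∫_I W(dx) f(x)`. The vector `v I` stands for `(W(I) + s M(I))⁻¹ f_I`. -/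
theorem Testing.bellman_add_le (hT : W.Testing A b) (hA : ∀ I, (A I).PosSemidef)
    {f : X → EuclideanSpace 𝕜 (Fin d)} (hf : W.MemL2 f) {s : ℝ} (hs : 0 ≤ s)
    {v : 𝓕.Atom → EuclideanSpace 𝕜 (Fin d)}
    (hv : ∀ I, toEuclideanLin (W I.carrier + s • W.testingSum A I) (v I) = W.integral I.carrier f)
    (I : 𝓕.Atom) :
    ENNReal.ofReal (RCLike.re (inner 𝕜 (W.integral I.carrier f) (v I))) +
        ENNReal.ofReal (s * quadForm (A I) (toEuclideanLin (W I.carrier) (v I))) ≤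
      ∑' J : children I, ENNReal.ofReal (RCLike.re (inner 𝕜 (W.integral J.1.carrier f) (v J))) ∧
    ENNReal.ofReal (RCLike.re (inner 𝕜 (W.integral I.carrier f) (v I))) ≤
      W.normSqOn I.carrier f := by
  set q : 𝓕.Atom → ℝ := fun I => RCLike.re (inner 𝕜 (W.integral I.carrier f) (v I)) with hq
  have hM : ∀ I, (W.testingSum A I).PosSemidef := hT.posSemidef_testingSum hA
  have hS : ∀ I : 𝓕.Atom, (W I.carrier + s • W.testingSum A I).PosSemidef := fun I =>
    (W.posSemidef_apply I).add ((hM I).smul hs)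
  have hqv : ∀ I, quadForm (W I.carrier + s • W.testingSum A I) (v I) = q I := fun I => by
    rw [quadForm, hv]; exact inner_re_symm _ _
  have hq0 : ∀ I, 0 ≤ q I := fun I => hqv I ▸ quadForm_nonneg (hS I) _
  have hmax : ∀ (J : 𝓕.Atom) u, 2 * RCLike.re (inner 𝕜 (W.integral J.carrier f) u) -
      quadForm (W J.carrier) u - s * quadForm (W.testingSum A J) u ≤ q J := by
    intro J u
    have h := two_mul_re_inner_sub_quadForm_le (hS J) (hv J) u
    rw [quadForm_add, quadForm_smul] at h
    linarith
  have hqn : ∀ J : children I, 0 ≤ q J.1 := fun J => hq0 J.1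
  have ht0 : 0 ≤ quadForm (A I) (toEuclideanLin (W I.carrier) (v I)) := quadForm_nonneg (hA I) _
  have hqeq : ∀ J : 𝓕.Atom, 2 * RCLike.re (inner 𝕜 (W.integral J.carrier f) (v J)) -
      quadForm (W J.carrier) (v J) - s * quadForm (W.testingSum A J) (v J) = q J := by
    intro J
    have h := hqv J
    rw [quadForm_add, quadForm_smul] at h
    change 2 * q J - _ - _ = _
    linarith
  have hqF : ∀ J : 𝓕.Atom, q J ≤ (W.normSqOn J.carrier f).toReal := by
    intro J
    have h1 := W.two_mul_re_inner_integral_sub_le hf J.mem_ring (v J)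
    have h2 := mul_nonneg hs (quadForm_nonneg (hM J) (v J))
    rw [← hqeq J]
    linarith
  have hqF' : ∀ J : 𝓕.Atom, ENNReal.ofReal (q J) ≤ W.normSqOn J.carrier f := fun J =>
    ENNReal.ofReal_le_of_le_toReal (hqF J)
  refine ⟨?_, hqF' I⟩
  have hqs : Summable fun J : children I => q J.1 := by
    refine summable_of_tsum_ofReal_ne_top hqn (ne_top_of_le_ne_top ?_
      (ENNReal.tsum_le_tsum fun J : children I => hqF' J.1))
    rw [W.tsum_normSqOn_children]
    exact (W.normSqOn_lt_top hf _).ne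
  have h1 : HasSum (fun J : children I =>
      RCLike.re (inner 𝕜 (W.integral J.1.carrier f) (v I))) (q I) := by
    have h := (W.hasSum_integral_children hf I).mapL (innerSL 𝕜 (v I))
    have h' := RCLike.hasSum_re 𝕜 h
    simp only [innerSL_apply_apply] at h'
    simpa only [hq, inner_re_symm (𝕜 := 𝕜) _ (v I)] using h'
  have h2 := _root_.hasSum_quadForm (W.hasSum_apply_children I) (v I)
  obtain ⟨hms, hmle⟩ := hT.summable_and_le hA I (v I)
  have h3 := ((h1.mul_left 2).sub h2).sub (hms.hasSum.mul_left s)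
  have h4 := hasSum_le (fun J : children I => hmax J.1 (v I)) h3 hqs.hasSum
  have h5 := hqeq I
  have h6 := mul_le_mul_of_nonneg_left hmle hs
  rw [← ENNReal.ofReal_add (hq0 I) (mul_nonneg hs ht0),
    ← ENNReal.ofReal_tsum_of_nonneg hqn hqs]
  refine ENNReal.ofReal_le_ofReal ?_
  have h7 : 2 * RCLike.re (inner 𝕜 (W.integral I.carrier f) (v I)) = 2 * q I := rfl
  linarith

/-- The Carleson embedding with `f_I` replaced by `W(I) (W(I) + s M(I))⁻¹ f_I`, which for `s = 0`
would be `f_I` itself. -/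
theorem Testing.tsum_resolvent_le (hT : W.Testing A b) (hA : ∀ I, (A I).PosSemidef)
    {f : X → EuclideanSpace 𝕜 (Fin d)} (hf : W.MemL2 f) {s : ℝ} (hs : 0 ≤ s)
    {v : 𝓕.Atom → EuclideanSpace 𝕜 (Fin d)}
    (hv : ∀ I, toEuclideanLin (W I.carrier + s • W.testingSum A I) (v I) =
      W.integral I.carrier f) :
    ENNReal.ofReal s * ∑' I : 𝓕.Atom,
      ENNReal.ofReal (quadForm (A I) (toEuclideanLin (W I.carrier) (v I))) ≤ W.normSq f := by
  rw [← ENNReal.tsum_mul_left]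
  simp only [← ENNReal.ofReal_mul hs]
  refine tsum_le_of_add_le_tsum_children (fun I => (hT.bellman_add_le hA hf hs hv I).1) fun n => ?_
  rw [← W.tsum_normSqOn_generation f n]
  exact ENNReal.tsum_le_tsum fun I => (hT.bellman_add_le hA hf hs hv I.1).2

end Testing

/-- The constant of the embedding theorem. -/
noncomputable def embeddingConst (d : ℕ) : ℝ≥0 :=
  Real.toNNReal ((d : ℝ) * interpolationBound d ^ 2 * d)

theorem quadForm_sum_smul_le {M : Matrix (Fin d) (Fin d) 𝕜} (hM : M.PosSemidef) {K : ℝ}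
    {n : ℕ} (c : ℕ → ℝ) (hc : ∀ k ∈ Finset.range n, |c k| ≤ K)
    (x : ℕ → EuclideanSpace 𝕜 (Fin d)) :
    quadForm M (∑ k ∈ Finset.range n, (c k : 𝕜) • x k) ≤
      n * K ^ 2 * ∑ k ∈ Finset.range n, quadForm M (x k) := by
  simp only [← norm_psdSqrt_sq hM, map_sum, map_smul]
  have h1 := norm_sum_le (Finset.range n) fun k => (c k : 𝕜) • toEuclideanLin (psdSqrt M) (x k)
  refine (pow_le_pow_left₀ (norm_nonneg _) h1 2).trans (sq_sum_le_card_mul_sum_sq.trans ?_)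
  rw [Finset.card_range, mul_assoc, Finset.mul_sum _ _ (K ^ 2)]
  refine mul_le_mul_of_nonneg_left (Finset.sum_le_sum fun k hk => ?_) (Nat.cast_nonneg n)
  rw [norm_smul, mul_pow, RCLike.norm_ofReal]
  exact mul_le_mul_of_nonneg_right (pow_le_pow_left₀ (abs_nonneg _) (hc k hk) 2) (sq_nonneg _)

theorem Testing.embedding_of_pos {W : MatrixMeasure 𝓕 𝕜 d} {b : ℝ≥0} (hT : W.Testing A b)
    (hA : ∀ I, (A I).PosSemidef) (hb : 0 < b) : W.Embedding A (embeddingConst d * b) := by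
  intro f hf
  have hb' : (0 : ℝ) < b := hb
  choose v c hv hc hsum using fun I : 𝓕.Atom => exists_resolvent_interpolation
    (W.posSemidef_apply I) (hT.posSemidef_testingSum hA I) hb' (hT I).2
    (W.exists_toEuclideanLin_eq_integral hf I.mem_ring)
  set K := interpolationBound d with hK
  have hK0 : 0 ≤ K := interpolationBound_nonneg d
  set Q : 𝓕.Atom → ℕ → ℝ := fun I k => quadForm (A I) (toEuclideanLin (W I.carrier) (v I k)) with hQ
  have hQ0 : ∀ I k, 0 ≤ Q I k := fun I k => quadForm_nonneg (hA I) _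
  have h1 : ∀ k : ℕ, ∑' I, ENNReal.ofReal (Q I k) ≤ ENNReal.ofReal b * W.normSq f := by
    intro k
    have hs : 0 < ((k : ℝ) + 1) / b := by positivity
    have h := hT.tsum_resolvent_le hA hf hs.le (v := fun I => v I k) fun I => hv I k
    calc ∑' I, ENNReal.ofReal (Q I k)
        ≤ ENNReal.ofReal b * (ENNReal.ofReal (((k : ℝ) + 1) / b) *
            ∑' I, ENNReal.ofReal (Q I k)) := by
          rw [← mul_assoc, ← ENNReal.ofReal_mul hb'.le, mul_div_cancel₀ _ hb'.ne']
          refine le_mul_of_one_le_left' ?_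
          rw [ENNReal.one_le_ofReal]
          linarith [(Nat.cast_nonneg k : (0 : ℝ) ≤ k)]
      _ ≤ _ := mul_le_mul_right h _
  have h2 : ∀ I : 𝓕.Atom, ENNReal.ofReal
      (‖toEuclideanLin (psdSqrt (A I)) (W.integral I.carrier f)‖ ^ 2) ≤
        ENNReal.ofReal (d * K ^ 2) * ∑ k ∈ Finset.range d, ENNReal.ofReal (Q I k) := by
    intro I
    rw [norm_psdSqrt_sq (hA I), ← ENNReal.ofReal_sum_of_nonneg fun k _ => hQ0 I k,
      ← ENNReal.ofReal_mul (by positivity)]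
    refine ENNReal.ofReal_le_ofReal ?_
    conv_lhs => rw [hsum I]
    exact quadForm_sum_smul_le (hA I) (c I) (hc I) _
  refine (ENNReal.tsum_le_tsum h2).trans ?_
  rw [ENNReal.tsum_mul_left, Summable.tsum_finsetSum fun _ _ => ENNReal.summable]
  calc ENNReal.ofReal (d * K ^ 2) * ∑ k ∈ Finset.range d, ∑' I, ENNReal.ofReal (Q I k)
      ≤ ENNReal.ofReal (d * K ^ 2) * ∑ _k ∈ Finset.range d, ENNReal.ofReal b * W.normSq f :=
        mul_le_mul_right (Finset.sum_le_sum fun k _ => h1 k) _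
    _ = (embeddingConst d * b : ℝ≥0) * W.normSq f := by
        rw [Finset.sum_const, Finset.card_range, nsmul_eq_mul, ENNReal.coe_mul, embeddingConst,
          ← ENNReal.ofReal, ENNReal.ofReal_mul (q := (d : ℝ)) (by positivity),
          ENNReal.ofReal_natCast, ENNReal.ofReal_coe_nnreal]
        ring

/-! ### Closedness of the sets of constants, and the limit case `b = 0` -/

theorem isClosed_embedding (A : 𝓕.Atom → Matrix (Fin d) (Fin d) 𝕜) :
    IsClosed {a : ℝ≥0 | W.Embedding A a} := by
  have h : {a : ℝ≥0 | W.Embedding A a} = ⋂ (f) (_ : W.MemL2 f), {a : ℝ≥0 |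
      ∑' I : 𝓕.Atom, ENNReal.ofReal
        (‖toEuclideanLin (psdSqrt (A I)) (W.integral I.carrier f)‖ ^ 2) ≤ a * W.normSq f} := by
    ext a; simp [Embedding]
  rw [h]
  refine isClosed_iInter fun f => isClosed_iInter fun hf => isClosed_le continuous_const ?_
  exact (ENNReal.continuous_mul_const hf.2.ne).comp ENNReal.continuous_coe

theorem Testing.mono {W : MatrixMeasure 𝓕 𝕜 d} {b b' : ℝ≥0} (hT : W.Testing A b) (h : b ≤ b') :
    W.Testing A b' := by
  intro I
  refine ⟨(hT I).1, ?_⟩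
  have h1 := (hT I).2.add
    ((W.posSemidef_apply I).smul (sub_nonneg.2 (NNReal.coe_le_coe.2 h)))
  rw [sub_smul] at h1
  convert h1 using 1
  abel

/-- The case `b = 0` follows from the case `b > 0` because the embedding constants form a closed
set. -/
theorem Testing.embedding {W : MatrixMeasure 𝓕 𝕜 d} {b : ℝ≥0} (hT : W.Testing A b)
    (hA : ∀ I, (A I).PosSemidef) : W.Embedding A (embeddingConst d * b) := by
  have h : Filter.Tendsto (fun b' : ℝ≥0 => embeddingConst d * b') (nhdsWithin b (Set.Ioi b))
      (nhds (embeddingConst d * b)) :=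
    ((continuous_const.mul continuous_id).tendsto b).mono_left nhdsWithin_le_nhds
  refine (W.isClosed_embedding A).mem_of_tendsto h ?_
  filter_upwards [self_mem_nhdsWithin] with b' hb'
  exact (hT.mono (le_of_lt hb')).embedding_of_pos hA (pos_of_gt hb')

theorem isClosed_testing (A : 𝓕.Atom → Matrix (Fin d) (Fin d) 𝕜)
    (hA : ∀ I, (A I).PosSemidef) : IsClosed {b : ℝ≥0 | W.Testing A b} := by
  have h : {b : ℝ≥0 | W.Testing A b} = ⋂ I₀ : 𝓕.Atom, {b : ℝ≥0 | Summable
      (fun I : {I : 𝓕.Atom // I.Sub I₀} => W I.1.carrier * A I.1 * W I.1.carrier)} ∩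
      ⋂ v, {b : ℝ≥0 | quadForm (W.testingSum A I₀) v ≤ b * quadForm (W I₀.carrier) v} := by
    ext b
    simp only [Set.mem_iInter, Set.mem_inter_iff, Set.mem_ofPred_eq]
    refine forall_congr' fun I₀ => and_congr_right fun _ => ⟨fun h v => ?_, fun h => ?_⟩
    · have := quadForm_nonneg h v
      rw [quadForm_sub, quadForm_smul] at this
      exact sub_nonneg.1 this
    · refine posSemidef_of_quadForm_nonneg (IsHermitian.sub ?_ (isHermitian_testingSum hA I₀))
        fun v => ?_
      · exact ((W.posSemidef_apply I₀).smul b.2).1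
      · rw [quadForm_sub, quadForm_smul]
        exact sub_nonneg.2 (h v)
  rw [h]
  refine isClosed_iInter fun I₀ => IsClosed.inter isClosed_const
    (isClosed_iInter fun v => isClosed_le continuous_const ?_)
  exact NNReal.continuous_coe.mul continuous_const

/-! ### Necessity of the testing condition -/

/-- Testing the embedding on the functions `1_{I₀} v`. -/
theorem Embedding.testing {W : MatrixMeasure 𝓕 𝕜 d} {a : ℝ≥0} (hE : W.Embedding A a)
    (hA : ∀ I, (A I).PosSemidef) : W.Testing A a := by
  intro I₀
  have hN : ∀ I : 𝓕.Atom, (W I.carrier * A I * W I.carrier).PosSemidef := fun I => by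
    have h := (hA I).mul_mul_conjTranspose_same (W I.carrier)
    rwa [(W.posSemidef_apply I).1.eq] at h
  have h1 : ∀ v, ∑' I : {I : 𝓕.Atom // I.Sub I₀},
      ENNReal.ofReal (quadForm (W I.1.carrier * A I.1 * W I.1.carrier) v) ≤
        ENNReal.ofReal (a * quadForm (W I₀.carrier) v) := by
    intro v
    have h := hE _ (W.memL2_indicator I₀.mem_ring v)
    rw [W.normSq_indicator I₀.mem_ring] at h
    rw [ENNReal.ofReal_mul NNReal.zero_le_coe]
    refine le_trans ?_ (h.trans_eq (by rw [ENNReal.ofReal_coe_nnreal]))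
    refine le_trans (ENNReal.tsum_le_tsum fun I => ?_)
      (ENNReal.tsum_comp_le_tsum_of_injective Subtype.val_injective _)
    rw [norm_psdSqrt_sq (hA I.1), W.integral_indicator_of_subset I.1.mem_ring I.2.1,
      quadForm_mul_mul (W.posSemidef_apply I.1).1]
  have h0 : ∀ (v : EuclideanSpace 𝕜 (Fin d)) (I : {I : 𝓕.Atom // I.Sub I₀}),
      0 ≤ quadForm (W I.1.carrier * A I.1 * W I.1.carrier) v := fun v I =>
    quadForm_nonneg (hN I.1) v
  have hs : ∀ v, Summable fun I : {I : 𝓕.Atom // I.Sub I₀} =>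
      quadForm (W I.1.carrier * A I.1 * W I.1.carrier) v := fun v =>
    summable_of_tsum_ofReal_ne_top (h0 v)
      (ne_top_of_le_ne_top ENNReal.ofReal_ne_top (h1 v))
  have htr : ∀ M : Matrix (Fin d) (Fin d) 𝕜, RCLike.re M.trace =
      ∑ j, quadForm M (EuclideanSpace.single j 1) := by
    intro M
    simp only [Matrix.trace, map_sum]
    refine Finset.sum_congr rfl fun j _ => ?_
    rw [quadForm, EuclideanSpace.inner_single_left]
    simp [toLpLin_apply]
  -- The entries of a positive semidefinite matrix are dominated by its trace, a finite sum of
  -- values of the quadratic form.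
  have hsum : Summable fun I : {I : 𝓕.Atom // I.Sub I₀} =>
      W I.1.carrier * A I.1 * W I.1.carrier := by
    refine Pi.summable.2 fun j => Pi.summable.2 fun k => ?_
    refine Summable.of_norm_bounded
      (summable_sum fun j (_ : j ∈ Finset.univ) => hs (EuclideanSpace.single j 1)) fun I => ?_
    exact (norm_apply_le (hN I.1) j k).trans_eq (htr _)
  refine ⟨hsum, posSemidef_of_quadForm_nonneg (IsHermitian.sub
    ((W.posSemidef_apply I₀).smul a.2).1 (isHermitian_testingSum hA I₀)) fun v => ?_⟩
  have h2 := hasSum_quadForm hsum.hasSum v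
  have h3 := h1 v
  rw [← ENNReal.ofReal_tsum_of_nonneg (h0 v) (hs v),
    ENNReal.ofReal_le_ofReal_iff
      (mul_nonneg NNReal.zero_le_coe (quadForm_nonneg (W.posSemidef_apply I₀) v)), h2.tsum_eq] at h3
  rw [quadForm_sub, quadForm_smul]
  exact sub_nonneg.2 h3

end MatrixMeasure

theorem theorem1p1 :
    ∃ C : ℕ → ℝ≥0,
      ∀ (d : ℕ) (𝕜 : Type*) [RCLike 𝕜] (X : Type*) [MeasurableSpace X]
        (𝓕 : AtomicFiltration X) (W : MatrixMeasure 𝓕 𝕜 d)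
        (A : 𝓕.Atom → Matrix (Fin d) (Fin d) 𝕜), (∀ I, (A I).PosSemidef) →
        ((∃ a : ℝ≥0, W.Embedding A a) ↔ ∃ b : ℝ≥0, W.Testing A b) ∧
        ((∃ a : ℝ≥0, W.Embedding A a) →
          ∃ a b : ℝ≥0, IsLeast {a | W.Embedding A a} a ∧ IsLeast {b | W.Testing A b} b ∧
            b ≤ a ∧ a ≤ C d * b) := by
  refine ⟨MatrixMeasure.embeddingConst, fun d 𝕜 _ X _ 𝓕 W A hA => ?_⟩
  refine ⟨⟨fun ⟨a, ha⟩ => ⟨a, ha.testing hA⟩, fun ⟨b, hb⟩ => ⟨_, hb.embedding hA⟩⟩, ?_⟩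
  rintro ⟨a₀, ha₀⟩
  have ha := (W.isClosed_embedding A).isLeast_csInf ⟨a₀, ha₀⟩ (OrderBot.bddBelow _)
  have hb := (W.isClosed_testing A hA).isLeast_csInf ⟨a₀, ha₀.testing hA⟩ (OrderBot.bddBelow _)
  exact ⟨_, _, ha, hb, hb.2 (MatrixMeasure.Embedding.testing ha.1 hA), ha.2 (MatrixMeasure.Testing.embedding hb.1 hA)⟩
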